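/- Let $\{L,R\}^*/\sim$ be the set of non-empty words in the letters $L,R$ modulo cyclic permutation of the letters and modulo the involution that reads a word backwards and interchanges $L$ and $R$. For a class $[w]$ let $|w|$ be the number of letters of $w$, $|[w]|$ the cardinality of the class, and $\lambda_{[w]}:=\frac{|[w]|}{2|w|}$. For a finite set $W$ of such classes put $m_W:=\max\{|w| : [w]\in W\}$ (with $m_\emptyset:=0$), and let $\mathbf Z_W=(Z_{[w]})_{[w]\in W}$ be a vector of independent Poisson random variables, $Z_{[w]}$ having parameter $\lambda_{[w]}$. For $N\ge 1$ let $\Omega_N$ be the set of all partitions of $\{1,\dots,6N\}$ into pairs, with the uniform probability measure $\mathbb P_N$. Each $\omega\in\Omega_N$ is a gluing of $2N$ oriented ideal triangles into an oriented cusped surface: the $i$-th triangle has sides labelled $3i-2,3i-1,3i$ in positive cyclic order, and sides whose labels are paired by $\omega$ are glued, respecting orientations. A nontrivial free homotopy class of unoriented closed curves on this surface is given by a closed sequence of ordered pairs $(a_1,b_1),\dots,(a_k,b_k)$, $k\geq 1$ (sides of entry and exit), where $a_i\ne b_i$ are sides of the same triangle and $\{b_i,a_{i+1}\}\in\omega$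 for $i=1,\dots,k$ (indices modulo $k$); two such sequences give the same homotopy class if and only if they differ by a cyclic permutation, possibly combined with reversal of direction $(a_1,b_1),\dots,(a_k,b_k)\mapsto (b_k,a_k),\dots,(b_1,a_1)$. Recording for each pair whether the curve turns left ($L$) or right ($R$) gives a word, and the homotopy class corresponds to the class of this word. A homotopy class is primitive if its sequence is not fixed by a nontrivial cyclic permutation, that is, if its curves do not run several times around a shorter closed curve. Let $Z_{[w],N}(\omega)$ be the number of primitive homotopy classes that correspond to $[w]$, and $\mathbf Z_{W,N}:=(Z_{[w],N})_{[w]\in W}$, a random vector on $(\Omega_N,\mathbb P_N)$. For random vectors $\mathbf X,\mathbf Y$ with values in $\mathbb N_0^W$ let $d_{mTV}(\mathbf X,\mathbf Y):=\sup_{B\subseteq \mathbb N_0^W}\big|\mathbb P[\mathbf X\in B]-\mathbb P[\mathbf Y\in B]\big|$. Suppose that $(W_N)_{N\in\mathbb N}$ is a sequence of finite subsets $W_N\subset\{L,R\}^*/\sim$ with $m_{W_N}\le N$ for all $N\geq 1$ and $$\lim_{N\to\infty}|W_N|^3\,(6m_{W_N})^{3m_{W_N}+4}\,\frac1N=0 .$$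 Then $$\lim_{N\to\infty}d_{mTV}\big(\mathbf Z_{W_N,N},\mathbf Z_{W_N}\big)=0 .$$ -/

import Mathlib

open MeasureTheory ProbabilityTheory Filter Topology
open scoped NNReal

noncomputable section

namespace RandomSurface

/-! ### Cyclic lists up to reversal -/

/-- For an involution `f` of `A`: two lists are equivalent if one is a cyclic permutation of the
other, or of the other read backwards with `f` applied to every entry. -/
def cyclicRevSetoid {A : Type} (f : A → A) (hf : Function.Involutive f) : Setoid (List A) where
  r v w := v ~r w ∨ v ~r (w.map f).reverse
  iseqv := by
    have hinv : ∀ l : List A, ((l.map f).reverse.map f).reverse = l := by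
      intro l
      simp [List.map_reverse, hf.comp_self]
    have hrot : ∀ {l l' : List A}, l ~r l' → (l.map f).reverse ~r (l'.map f).reverse :=
      fun h => (h.map f).reverse
    refine ⟨fun l => Or.inl (List.IsRotated.refl l), ?_, ?_⟩
    · rintro v w (h | h)
      · exact Or.inl h.symm
      · refine Or.inr ?_
        have := hrot h
        rw [hinv] at this
        exact this.symm
    · rintro u v w (h | h) (h' | h')
      · exact Or.inl (h.trans h')
      · exact Or.inr (h.trans h')
      · exact Or.inr (h.trans (hrot h'))
      · refine Or.inl (h.trans ?_)
        have := hrot h'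
        rwa [hinv] at this

theorem cyclicRevSetoid_length {A : Type} (f : A → A) (hf : Function.Involutive f)
    (v w : List A) (h : (cyclicRevSetoid f hf).r v w) : v.length = w.length := by
  rcases h with h | h
  · exact h.perm.length_eq
  · simpa using h.perm.length_eq

/-! ### Words in `L` and `R` -/

/-- The two letters: left turn and right turn. -/
inductive Turn : Type
  | L
  | R
  deriving DecidableEq

/-- Interchange `L` and `R`. -/
def Turn.swap : Turn → Turn
  | .L => .R
  | .R => .L

theorem Turn.swap_involutive : Function.Involutive Turn.swap := by
  intro t; cases t <;> rfl

/-- `{L,R}^* / ∼`: words up to cyclic permutation of the letters and up to reading the word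
backwards while interchanging `L` and `R`. -/
abbrev WordClass : Type := Quotient (cyclicRevSetoid Turn.swap Turn.swap_involutive)

/-- The class `[w]` of a word. -/
def WordClass.mk (w : List Turn) : WordClass := Quotient.mk _ w

/-- The number `|w|` of letters of a word `w` in the class. -/
def WordClass.length : WordClass → ℕ :=
  Quotient.lift List.length (cyclicRevSetoid_length _ _)

/-- The cardinality `|[w]|` of the class. -/
def WordClass.size (c : WordClass) : ℕ := {w : List Turn | WordClass.mk w = c}.ncard

/-- The Poisson parameter `λ_[w] = |[w]| / (2 |w|)`. -/
def WordClass.rate (c : WordClass) : ℝ≥0 := (c.size : ℝ≥0) / (2 * (c.length : ℝ≥0))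

/-- `m_W`, the maximal length of a word in `W` (equal to `0` if `W` is empty). -/
def maxLength (W : Finset WordClass) : ℕ := W.sup WordClass.length

/-! ### The probability space of random gluings of `2N` triangles -/

/-- Labels of the sides of the `2N` triangles. We number from `0`, so that the `i`-th triangle
has the sides `3i, 3i+1, 3i+2`. -/
abbrev Label (N : ℕ) : Type := Fin (6 * N)

/-- `Ω_N`: partitions of the set of the `6N` labels into pairs. -/
abbrev Gluing (N : ℕ) : Type :=
  {P : Finpartition (Finset.univ : Finset (Label N)) // ∀ p ∈ P.parts, p.card = 2}

instance (N : ℕ) : MeasurableSpace (Gluing N) := ⊤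

/-- `ℙ_N`: the normalized counting measure on `Ω_N`. -/
def gluingMeasure (N : ℕ) : Measure (Gluing N) := uniformOn Set.univ

/-! ### Closed curves on the glued surface -/

/-- A passage of a curve through a triangle: an ordered pair (side of entry, side of exit) of
distinct sides of the same triangle. -/
abbrev Passage (N : ℕ) : Type :=
  {p : Label N × Label N // p.1 ≠ p.2 ∧ p.1.val / 3 = p.2.val / 3}

/-- The same passage, traversed in the opposite direction. -/
def Passage.flip {N : ℕ} (s : Passage N) : Passage N :=
  ⟨(s.1.2, s.1.1), s.2.1.symm, s.2.2.symm⟩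

theorem Passage.flip_involutive {N : ℕ} :
    Function.Involutive (Passage.flip : Passage N → Passage N) := fun _ => rfl

/-- The turn made at a passage. The cyclic order `3i, 3i+1, 3i+2` of the sides is the positive
(counterclockwise) one, so leaving through the side that follows the side of entry in this order
is a turn to the right, and leaving through the other one is a turn to the left. -/
def Passage.turn {N : ℕ} (s : Passage N) : Turn :=
  if s.1.2.val % 3 = (s.1.1.val + 1) % 3 then Turn.R else Turn.L

/-- The sequence of passages `α` occurs as a closed curve in the surface glued according to `ω`:
cyclically, the side of exit of every passage is glued to the side of entry of the next one. -/
def OccursIn {N : ℕ} (ω : Gluing N) (α : List (Passage N)) : Prop :=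
  Cycle.Chain (fun s t : Passage N => ({s.1.2, t.1.1} : Finset (Label N)) ∈ ω.1.parts)
    (α : Cycle (Passage N))

/-- The closed curve `α` is primitive, i.e. it does not run several times around a shorter closed
curve: no nontrivial rotation of the cyclic sequence fixes it. -/
def IsPrimitive {N : ℕ} (α : List (Passage N)) : Prop :=
  ∀ j : ℕ, 0 < j → j < α.length → α.rotate j ≠ α

/-- Sequences of passages up to the choice of starting point and of direction. The nonempty ones
that occur in `ω` represent bijectively the nontrivial free homotopy classes of unoriented closed
curves on the cusped surface glued according to `ω`: a homotopy class is represented by the cyclic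
sequence of sides crossed by those of its curves that never leave a triangle through the side of
entry (such as the closed geodesic, if the class contains one), which is unique up to starting
point and direction. -/
abbrev CurveClass (N : ℕ) : Type :=
  Quotient (cyclicRevSetoid (Passage.flip (N := N)) Passage.flip_involutive)

/-- The homotopy classes of primitive closed curves on the surface glued according to `ω` that
correspond to the class `c` of words. -/
def curvesOfType {N : ℕ} (ω : Gluing N) (c : WordClass) : Set (CurveClass N) :=
  {γ | ∃ α : List (Passage N), Quotient.mk _ α = γ ∧ OccursIn ω α ∧ IsPrimitive α ∧
    WordClass.mk (α.map Passage.turn) = c}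

/-- The random variable `Z_{[w],N} : Ω_N → ℕ`. -/
def curveCount (N : ℕ) (c : WordClass) (ω : Gluing N) : ℕ := (curvesOfType ω c).ncard

/-- The random vector `𝐙_{W,N} = (Z_{[w],N})_{[w] ∈ W}`. -/
def curveCountVector (N : ℕ) (W : Finset WordClass) (ω : Gluing N) : W → ℕ :=
  fun c => curveCount N c.1 ω

/-! ### The limit vector and the distance -/

/-- The law of `𝐙_W`, a vector of independent Poisson variables `Z_[w]` with parameters
`λ_[w]`, `[w] ∈ W`. -/
def poissonVectorLaw (W : Finset WordClass) : Measure (W → ℕ) :=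
  Measure.pi fun c : W => poissonMeasure c.1.rate

/-- The multivariate total variation distance between two laws on `ℕ₀^ι`. -/
def dmTV {ι : Type} (μ ν : Measure (ι → ℕ)) : ℝ :=
  ⨆ B : Set (ι → ℕ), |μ.real B - ν.real B|

end RandomSurface

end

open MeasureTheory ProbabilityTheory Filter Topology
open scoped NNReal

noncomputable section

namespace RandomSurface

/-! ### Stein's method for a vector of independent Poisson variables -/

/-! The proof combines Stein's method with a switching argument for random matchings.

Write Z for the vector of counts and e_c for a unit vector. To compare the law of Z with the product
Poisson law, it suffices to bound E[λ_c g(Z + e_c) - Z_c g(Z)] for every coordinate c and every g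
bounded by 3. Coordinates are resampled one at a time (`dmTV_pi_poisson_le`), and each resampling is
controlled by a bounded solution of the one-dimensional Stein equation (`exists_stein_solution`,
`dmTV_map_uniform_le`).

Gluings are fixed point free involutions of the labels. A primitive curve class of length k is
represented by exactly 2k cyclic sequences of passages (`two_mul_curveCount`), so E[Z_c g(Z)] is
1/(2k) times the sum, over primitive sequences s of type c, of P(s occurs) E[g(Z) | s occurs].
Sequences through k distinct triangles (`Simple`) give the main term: there are
(2N)(2N-1)...(2N-k+1) 3^k |[w]| of them, and each occurs with probability 1/∏(6N-2i-1), so their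
probabilities add up to almost |[w]| = 2k λ_c. A primitive sequence that is not simple needs at
least one more pair than it has triangles (`Occurs.card_ge_of_not_simple`), which costs a factor of
order 1/N.

It remains to see that conditioning on a simple curve α changes the law of Z by little more than
adding e_c. The pairs of α are prescribed one at a time, and each step is a switch of partners
(`avg_eq_sum_switch`). A switch affects the remaining curves only if a primitive curve other than α
passes through one of the re-paired sides. Even when part of α is given, such a curve needs more new
pairs than new triangles (`Occurs.card_ge_of_mem_labels`), so the expected number of these curves is
of order 1/N for bounded length. The resulting estimate `abs_stein_le` is summed over the classes in
W. -/

/-- Since k! j! ≤ (k+j)! and r ≤ 1, the series is dominated by ∑ 1/j! = e < 3. This is the origin of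
the constant 3 in all later bounds on test functions. -/
theorem summable_steinSeries (r : ℝ) (hr0 : 0 ≤ r) (hr : r ≤ 1) (h : ℕ → ℝ) (hh : ∀ k, |h k| ≤ 1)
    (k : ℕ) :
    Summable (fun j : ℕ => h (k + j) * r ^ j * k.factorial / (k + j).factorial) ∧
      |∑' j : ℕ, h (k + j) * r ^ j * k.factorial / (k + j).factorial| ≤ 3 := by
  have hle : ∀ j : ℕ, ‖h (k + j) * r ^ j * k.factorial / (k + j).factorial‖
      ≤ 1 / (j.factorial : ℝ) := by
    intro j
    have h1 : (k.factorial : ℝ) * j.factorial ≤ (k + j).factorial := by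
      exact_mod_cast Nat.le_of_dvd (Nat.factorial_pos _) (Nat.factorial_mul_factorial_dvd_factorial_add k j)
    have hj : (0 : ℝ) < j.factorial := by exact_mod_cast Nat.factorial_pos j
    have hkj : (0 : ℝ) < (k + j).factorial := by exact_mod_cast Nat.factorial_pos _
    have h2 : |h (k + j)| * r ^ j ≤ 1 := mul_le_one₀ (hh _) (by positivity) (pow_le_one₀ hr0 hr)
    rw [Real.norm_eq_abs, abs_div, abs_mul, abs_mul, abs_of_nonneg (pow_nonneg hr0 j),
      Nat.abs_cast, Nat.abs_cast, div_le_div_iff₀ hkj hj]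
    have := mul_le_mul_of_nonneg_right h2 (by positivity : (0 : ℝ) ≤ k.factorial * j.factorial)
    nlinarith
  have hs : Summable (fun j : ℕ => 1 / (j.factorial : ℝ)) := by
    simpa using Real.summable_pow_div_factorial 1
  have he : ∑' j : ℕ, 1 / (j.factorial : ℝ) = Real.exp 1 := by
    rw [Real.exp_eq_exp_ℝ, NormedSpace.exp_eq_tsum_div]; simp
  refine ⟨Summable.of_norm_bounded hs hle, ?_⟩
  have := tsum_of_norm_bounded hs.hasSum hle
  rw [he] at this
  have h3 := Real.exp_one_lt_d9
  rw [Real.norm_eq_abs] at this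
  linarith

/-- The one-dimensional Stein equation for the Poisson law has a bounded solution. -/
theorem exists_stein_solution (r : ℝ≥0) (hr : r ≤ 1) (f : ℕ → ℝ)
    (hf : ∀ k, 0 ≤ f k ∧ f k ≤ 1) :
    ∃ g : ℕ → ℝ, (∀ k, |g k| ≤ 3) ∧
      ∀ k : ℕ, (r : ℝ) * g (k + 1) - k * g k = f k - ∫ i, f i ∂(poissonMeasure r) := by
  set c := ∫ i, f i ∂(poissonMeasure r) with hc
  have hint : Integrable f (poissonMeasure r) :=
    Integrable.of_bound (measurable_of_countable f).aestronglyMeasurable 1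
      (.of_forall fun k => by rw [Real.norm_eq_abs, abs_of_nonneg (hf k).1]; exact (hf k).2)
  have hc0 : 0 ≤ c := integral_nonneg fun k => (hf k).1
  have hc1 : c ≤ 1 := by
    have := integral_mono hint (integrable_const (1 : ℝ)) (fun k => (hf k).2)
    simpa using this
  set h : ℕ → ℝ := fun k => f k - c with hdef
  have hh : ∀ k, |h k| ≤ 1 := fun k => by
    rw [abs_le]; constructor <;> simp only [hdef] <;> linarith [(hf k).1, (hf k).2]
  set S : ℕ → ℝ := fun k => ∑' j : ℕ, h (k + j) * (r : ℝ) ^ j * k.factorial / (k + j).factorial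
    with hS
  have hsum := fun k => (summable_steinSeries r r.2 (by exact_mod_cast hr) h hh k)
  have hrec : ∀ k, S k = h k + r / (k + 1) * S (k + 1) := by
    intro k
    simp only [hS]
    rw [(hsum k).1.tsum_eq_zero_add, ← tsum_mul_left]
    congr 1
    · have : (k.factorial : ℝ) ≠ 0 := by exact_mod_cast Nat.factorial_ne_zero k
      simp [mul_div_assoc, div_self this]
    · refine tsum_congr fun j => ?_
      have h1 : ((k + 1 : ℕ).factorial : ℝ) = (k + 1) * k.factorial := by
        rw [Nat.factorial_succ]; push_cast; ring
      have h2 : ((k : ℝ) + 1) ≠ 0 := by positivity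
      rw [h1, show k + 1 + j = k + (j + 1) by ring]
      field_simp
      ring
  -- `S 0` is exp(r) times the Poisson mean of the centred function `h`.
  have hS0 : S 0 = 0 := by
    have hint' : Integrable h (poissonMeasure r) := hint.sub (integrable_const c)
    have h1 := hasSum_integral_poissonMeasure hint'
    have h2 : ∫ i, h i ∂(poissonMeasure r) = 0 := by
      simp only [hdef]
      rw [integral_sub hint (integrable_const c)]; simp [← hc]
    rw [h2] at h1
    have h3 := (h1.mul_left (Real.exp r)).tsum_eq
    rw [mul_zero] at h3
    rw [← h3]
    refine tsum_congr fun j => ?_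
    have : Real.exp (r : ℝ) * Real.exp (-(r : ℝ)) = 1 := by rw [← Real.exp_add]; simp
    simp only [smul_eq_mul, zero_add, Nat.factorial_zero, Nat.cast_one, mul_one]
    linear_combination (-(h j) * (r : ℝ) ^ j / j.factorial) * this
  -- Division by zero sets the value at 0 to 0; this is harmless because the equation multiplies it
  -- by k = 0. At k = 0 the equation is equivalent to `S 0 = 0`.
  refine ⟨fun k => - S k / k, ?_, ?_⟩
  · intro k
    rcases Nat.eq_zero_or_pos k with rfl | hk
    · simp
    · have : (1 : ℝ) ≤ k := by exact_mod_cast hk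
      rw [abs_div, abs_neg, Nat.abs_cast]
      exact (div_le_self (abs_nonneg _) this).trans (hsum k).2
  · intro k
    have h1 := hrec k
    have h2 : ((k : ℝ) + 1) ≠ 0 := by positivity
    have h3 : (k : ℝ) * (-S k / k) = - S k := by
      rcases Nat.eq_zero_or_pos k with rfl | hk
      · simp [hS0]
      · have : (k : ℝ) ≠ 0 := by positivity
        field_simp
    rw [h3]
    push_cast
    have h4 : h k = f k - c := rfl
    rw [← h4, h1]
    ring

/-! ### From the one-dimensional Stein equation to product laws -/

section Poisson

variable {ι : Type} [DecidableEq ι]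

/-- Replace the coordinate `c` by an independent Poisson variable and average. -/
def resample (r : ι → ℝ≥0) (c : ι) (f : (ι → ℕ) → ℝ) (z : ι → ℕ) : ℝ :=
  ∫ k, f (Function.update z c k) ∂(poissonMeasure (r c))

theorem integrable_of_mem_unitInterval {α : Type} [MeasurableSpace α] [Countable α]
    [MeasurableSingletonClass α] (μ : Measure α) [IsProbabilityMeasure μ]
    (f : α → ℝ) (hf : ∀ a, 0 ≤ f a ∧ f a ≤ 1) : Integrable f μ :=
  Integrable.of_bound (measurable_of_countable f).aestronglyMeasurable 1
    (.of_forall fun k => by rw [Real.norm_eq_abs, abs_of_nonneg (hf k).1]; exact (hf k).2)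

theorem integral_mem_unitInterval {α : Type} [MeasurableSpace α] [Countable α]
    [MeasurableSingletonClass α] (μ : Measure α) [IsProbabilityMeasure μ]
    (f : α → ℝ) (hf : ∀ a, 0 ≤ f a ∧ f a ≤ 1) : 0 ≤ ∫ a, f a ∂μ ∧ ∫ a, f a ∂μ ≤ 1 := by
  refine ⟨integral_nonneg fun k => (hf k).1, ?_⟩
  have := integral_mono (integrable_of_mem_unitInterval μ f hf) (integrable_const (1 : ℝ))
    (fun k => (hf k).2)
  simpa using this

theorem resample_mem_unitInterval (r : ι → ℝ≥0) (c : ι) (f : (ι → ℕ) → ℝ)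
    (hf : ∀ z, 0 ≤ f z ∧ f z ≤ 1) (z : ι → ℕ) :
    0 ≤ resample r c f z ∧ resample r c f z ≤ 1 :=
  integral_mem_unitInterval _ _ fun _ => hf _

variable [Fintype ι]

/-- The product Poisson law is invariant under resampling one coordinate. -/
theorem integral_resample (r : ι → ℝ≥0) (c : ι) (f : (ι → ℕ) → ℝ)
    (hf : ∀ z, 0 ≤ f z ∧ f z ≤ 1) :
    ∫ z, resample r c f z ∂(Measure.pi fun i => poissonMeasure (r i)) =
      ∫ z, f z ∂(Measure.pi fun i => poissonMeasure (r i)) := by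
  set π := Measure.pi fun i => poissonMeasure (r i) with hπ
  have hmap : (π.prod (poissonMeasure (r c))).map
      (fun p : (ι → ℕ) × ℕ => Function.update p.1 c p.2) = π := by
    refine (Measure.pi_eq fun s _ => ?_).symm
    rw [Measure.map_apply (measurable_of_countable _) (Set.to_countable _).measurableSet]
    have : (fun p : (ι → ℕ) × ℕ => Function.update p.1 c p.2) ⁻¹' (Set.univ.pi s)
        = (Set.univ.pi (Function.update s c Set.univ)) ×ˢ (s c) := by
      ext ⟨z, k⟩
      simp only [Set.mem_preimage, Set.mem_pi, Set.mem_univ, true_implies, Set.mem_prod]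
      constructor
      · intro h
        refine ⟨fun i => ?_, by simpa using h c⟩
        by_cases hi : i = c
        · subst hi; simp
        · simpa [hi] using h i
      · rintro ⟨h, hk⟩ i
        by_cases hi : i = c
        · subst hi; simpa using hk
        · simpa [hi] using h i
    rw [this, Measure.prod_prod, hπ, Measure.pi_pi, ← Finset.mul_prod_erase _ _ (Finset.mem_univ c),
      ← Finset.mul_prod_erase (Finset.univ) (fun i => poissonMeasure (r i) (s i))
        (Finset.mem_univ c)]
    simp only [Function.update_self, measure_univ, one_mul]
    rw [mul_comm]
    congr 1
    refine Finset.prod_congr rfl fun i hi => ?_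
    rw [Function.update_of_ne (Finset.ne_of_mem_erase hi)]
  conv_rhs => rw [← hmap]
  rw [integral_map (measurable_of_countable _).aemeasurable
    (measurable_of_countable f).aestronglyMeasurable,
    integral_prod _ (integrable_of_mem_unitInterval _ _ fun _ => hf _)]
  rfl

/-- If a probability law is almost invariant under resampling each coordinate, then it is close
to the product Poisson law in total variation. -/
theorem dmTV_pi_poisson_le (r : ι → ℝ≥0) (μ : Measure (ι → ℕ)) [IsProbabilityMeasure μ]
    (ε : ι → ℝ)
    (hε : ∀ c, ∀ f : (ι → ℕ) → ℝ, (∀ z, 0 ≤ f z ∧ f z ≤ 1) →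
      |∫ z, f z ∂μ - ∫ z, resample r c f z ∂μ| ≤ ε c) :
    dmTV μ (Measure.pi fun i => poissonMeasure (r i)) ≤ ∑ c, ε c := by
  set π := Measure.pi fun i => poissonMeasure (r i) with hπ
  -- Resampling the coordinates in `s` makes the function independent of them, keeps its mean under
  -- π, and moves its mean under μ by at most the sum of the corresponding `ε`. For `s` the whole
  -- index set the function is constant, so its two means agree.
  have key : ∀ (s : Finset ι) (f : (ι → ℕ) → ℝ), (∀ z, 0 ≤ f z ∧ f z ≤ 1) →
      ∃ F : (ι → ℕ) → ℝ, (∀ z, 0 ≤ F z ∧ F z ≤ 1) ∧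
        (∀ z z', (∀ i ∉ s, z i = z' i) → F z = F z') ∧
        |∫ z, f z ∂μ - ∫ z, F z ∂μ| ≤ ∑ c ∈ s, ε c ∧ ∫ z, f z ∂π = ∫ z, F z ∂π := by
    intro s f hf
    induction s using Finset.induction_on with
    | empty =>
      refine ⟨f, hf, fun z z' h => ?_, by simp, rfl⟩
      rw [show z = z' from funext fun i => h i (by simp)]
    | insert c s hc ih =>
      obtain ⟨F, hF, hdep, hb, hi⟩ := ih
      refine ⟨resample r c F, resample_mem_unitInterval r c F hF, ?_, ?_, ?_⟩
      · intro z z' h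
        unfold resample
        congr 1
        ext k
        refine hdep _ _ fun i hi => ?_
        by_cases hic : i = c
        · subst hic; simp
        · rw [Function.update_of_ne hic, Function.update_of_ne hic]
          exact h i (by simp [hic, hi])
      · rw [Finset.sum_insert hc]
        have := hε c F hF
        have h3 := abs_add_le (∫ z, f z ∂μ - ∫ z, F z ∂μ)
          (∫ z, F z ∂μ - ∫ z, resample r c F z ∂μ)
        rw [sub_add_sub_cancel] at h3
        linarith
      · rw [hi, integral_resample r c F hF]
  have hnn : 0 ≤ ∑ c, ε c := by
    obtain ⟨F, _, _, hb, _⟩ := key Finset.univ (fun _ => 0) (by simp)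
    exact (abs_nonneg _).trans hb
  refine Real.iSup_le (fun B => ?_) hnn
  have hB : MeasurableSet B := (Set.to_countable B).measurableSet
  have hind : ∀ z, 0 ≤ B.indicator (1 : (ι → ℕ) → ℝ) z ∧ B.indicator (1 : (ι → ℕ) → ℝ) z ≤ 1 := by
    intro z; by_cases hz : z ∈ B <;> simp [hz]
  obtain ⟨F, hF, hdep, hb, hi⟩ := key Finset.univ (B.indicator 1) hind
  have hconst : F = fun _ => F 0 := funext fun z => hdep _ _ (by simp)
  rw [← integral_indicator_one hB, ← integral_indicator_one hB, hi]
  have : ∫ z, F z ∂π = ∫ z, F z ∂μ := by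
    rw [hconst]; simp
  rw [this]
  exact hb

/-- Stein's method: control of the Stein operator in each coordinate bounds the distance of the
law of a random vector from the product Poisson law. -/
theorem dmTV_map_uniform_le {Ω : Type} [Fintype Ω] [Nonempty Ω] [MeasurableSpace Ω]
    [MeasurableSingletonClass Ω] (r : ι → ℝ≥0) (hr : ∀ c, r c ≤ 1) (Z : Ω → ι → ℕ) (ε : ι → ℝ)
    (hε : ∀ c, ∀ g : (ι → ℕ) → ℝ, (∀ z, |g z| ≤ 3) →
      |(∑ ω, ((r c : ℝ) * g (Z ω + Pi.single c 1) - Z ω c * g (Z ω))) / Fintype.card Ω| ≤ ε c) :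
    dmTV ((uniformOn (Set.univ : Set Ω)).map Z) (Measure.pi fun i => poissonMeasure (r i))
      ≤ ∑ c, ε c := by
  have hP : IsProbabilityMeasure (uniformOn (Set.univ : Set Ω)) :=
    isProbabilityMeasure_uniformOn Set.finite_univ Set.univ_nonempty
  have hZ : Measurable Z := measurable_of_countable Z
  have : IsProbabilityMeasure ((uniformOn (Set.univ : Set Ω)).map Z) :=
    Measure.isProbabilityMeasure_map hZ.aemeasurable
  have hint : ∀ f : (ι → ℕ) → ℝ, ∫ z, f z ∂((uniformOn (Set.univ : Set Ω)).map Z)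
      = (∑ ω, f (Z ω)) / Fintype.card Ω := by
    intro f
    rw [integral_map hZ.aemeasurable (measurable_of_countable f).aestronglyMeasurable,
      integral_fintype (Integrable.of_finite), div_eq_inv_mul, Finset.mul_sum]
    refine Finset.sum_congr rfl fun ω _ => ?_
    rw [smul_eq_mul]
    congr 1
    rw [measureReal_def, uniformOn_univ, Measure.count_singleton]
    simp
  refine dmTV_pi_poisson_le r _ ε fun c f hf => ?_
  choose g hg hgeq using fun z : ι → ℕ => exists_stein_solution (r c) (hr c)
    (fun k => f (Function.update z c k)) (fun k => hf _)
  -- The Stein equation is solved in coordinate c with the others frozen. Normalizing the parameter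
  -- to have coordinate c equal to 0 ensures that the same solution serves z and z + e_c.
  have hrep : ∀ z : ι → ℕ, f z - resample r c f z =
      (r c : ℝ) * g (Function.update z c 0) (z c + 1) - z c * g (Function.update z c 0) (z c) := by
    intro z
    rw [hgeq]
    simp [resample]
  rw [hint, hint, ← sub_div, ← Finset.sum_sub_distrib]
  have := hε c (fun z => g (Function.update z c 0) (z c)) (fun z => hg _ _)
  convert this using 4 with ω
  rw [hrep]
  have h1 : Function.update (Z ω + Pi.single c 1) c 0 = Function.update (Z ω) c 0 := by
    ext i
    by_cases hi : i = c
    · subst hi; simp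
    · simp [hi]
  rw [h1]
  simp

end Poisson

/-! ### Perfect matchings as fixed point free involutions -/

section Matching

variable {V : Type}

/-- A perfect matching of `V`, seen as the involution exchanging partners. -/
def IsMatching (σ : Equiv.Perm V) : Prop := ∀ x, σ x ≠ x ∧ σ (σ x) = x

/-- A set of vertices that is a union of pairs of `τ`. -/
def ClosedUnder (τ : Equiv.Perm V) (A : Finset V) : Prop := ∀ x ∈ A, τ x ∈ A

variable {τ : Equiv.Perm V}

theorem ClosedUnder.notMem (hτ : IsMatching τ) {A : Finset V} (hA : ClosedUnder τ A) {a : V}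
    (ha : a ∉ A) : τ a ∉ A := fun h => ha (by simpa [(hτ a).2] using hA _ h)

variable [DecidableEq V]

/-- Change the partners of `y` and `b`. -/
def switch (y b : V) (σ : Equiv.Perm V) : Equiv.Perm V := Equiv.swap y b * σ * Equiv.swap y b

theorem switch_apply (y b : V) (σ : Equiv.Perm V) (x : V) :
    switch y b σ x = Equiv.swap y b (σ (Equiv.swap y b x)) := rfl

theorem switch_switch (y b : V) (σ : Equiv.Perm V) : switch y b (switch y b σ) = σ := by
  ext x; simp [switch_apply]

theorem IsMatching.switch {σ : Equiv.Perm V} (h : IsMatching σ) (y b : V) :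
    IsMatching (switch y b σ) := by
  intro x
  refine ⟨fun hx => ?_, ?_⟩
  · rw [switch_apply] at hx
    apply (h (Equiv.swap y b x)).1
    apply (Equiv.swap y b).injective
    rw [hx]; simp
  · rw [switch_apply, switch_apply, Equiv.swap_apply_self, (h _).2]
    simp

/-- A switch affects only the pairs containing y and b, hence at most four labels. -/
theorem switch_apply_of_ne {σ : Equiv.Perm V} (h : IsMatching σ) {y b x : V} (h1 : x ≠ y)
    (h2 : x ≠ b) (h3 : x ≠ σ y) (h4 : x ≠ σ b) : switch y b σ x = σ x := by
  rw [switch_apply, Equiv.swap_apply_of_ne_of_ne h1 h2, Equiv.swap_apply_of_ne_of_ne]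
  · rintro h'; apply h3; rw [← h', (h x).2]
  · rintro h'; apply h4; rw [← h', (h x).2]

/-- Add a pair of `τ` to a set. -/
def addPair (τ : Equiv.Perm V) (a : V) (A : Finset V) : Finset V := insert a (insert (τ a) A)

theorem ClosedUnder.addPair (hτ : IsMatching τ) {A : Finset V} (hA : ClosedUnder τ A) (a : V) :
    ClosedUnder τ (addPair τ a A) := by
  intro x hx
  simp only [RandomSurface.addPair, Finset.mem_insert] at hx ⊢
  rcases hx with rfl | rfl | hx
  · simp
  · left; exact (hτ a).2
  · right; right; exact hA x hx

theorem card_addPair (hτ : IsMatching τ) {A : Finset V} (hA : ClosedUnder τ A) {a : V}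
    (ha : a ∉ A) : (addPair τ a A).card = A.card + 2 := by
  rw [addPair, Finset.card_insert_of_notMem, Finset.card_insert_of_notMem (hA.notMem hτ ha)]
  simp only [Finset.mem_insert, not_or]
  exact ⟨(hτ a).1.symm, ha⟩

theorem addPair_subset {A B : Finset V} (hB : ClosedUnder τ B) (hAB : A ⊆ B) {a : V} (ha : a ∈ B) :
    addPair τ a A ⊆ B := by
  intro x hx
  simp only [addPair, Finset.mem_insert] at hx
  rcases hx with rfl | rfl | hx
  · exact ha
  · exact hB _ ha
  · exact hAB hx

/-- Induction between two unions of pairs, adding one pair at a time. -/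
theorem closed_induction (hτ : IsMatching τ) (P : Finset V → Prop) {B : Finset V}
    (hB : ClosedUnder τ B) (n : ℕ) {A : Finset V} (hn : (B \ A).card = n) (hA : ClosedUnder τ A)
    (hAB : A ⊆ B) (h0 : P A)
    (hstep : ∀ C a, ClosedUnder τ C → A ⊆ C → C ⊆ B → a ∈ B → a ∉ C → P C → P (addPair τ a C)) :
    P B := by
  induction n using Nat.strong_induction_on generalizing A with
  | _ n ih =>
    by_cases h : B ⊆ A
    · rwa [Finset.Subset.antisymm h hAB]
    · obtain ⟨a, haB, haA⟩ := Finset.not_subset.mp h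
      have hsub : A ⊆ addPair τ a A := fun x hx => by simp [addPair, hx]
      refine ih _ ?_ rfl (hA.addPair hτ a) (addPair_subset hB hAB haB)
        (hstep A a hA subset_rfl hAB haB haA h0)
        (fun C b hC h1 h2 hb hbC => hstep C b hC (hsub.trans h1) h2 hb hbC)
      rw [← hn]
      refine Finset.card_lt_card ⟨Finset.sdiff_subset_sdiff subset_rfl hsub, fun h' => ?_⟩
      have := h' (Finset.mem_sdiff.mpr ⟨haB, haA⟩)
      simp [addPair] at this

theorem ClosedUnder.even_card_sdiff (hτ : IsMatching τ) {A B : Finset V} (hB : ClosedUnder τ B)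
    (hA : ClosedUnder τ A) (hAB : A ⊆ B) : ∃ e, B.card = A.card + 2 * e := by
  refine closed_induction hτ (fun C => ∃ e, C.card = A.card + 2 * e) hB _ rfl hA hAB ⟨0, by simp⟩ ?_
  rintro C a hC - - - ha ⟨e, he⟩
  exact ⟨e + 1, by rw [card_addPair hτ hC ha, he]; ring⟩

/-- Prescribed disjoint pairs can be completed to a perfect matching. -/
theorem exists_matching_extending {ι : Type} [DecidableEq ι] (hτ : IsMatching τ) (p q : ι → V)
    (hp : Function.Injective p) (hq : Function.Injective q) (hpq : ∀ i j, p i ≠ q j)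
    (s : Finset ι) : ∃ σ : Equiv.Perm V, IsMatching σ ∧ ∀ i ∈ s, σ (p i) = q i := by
  induction s using Finset.induction_on with
  | empty => exact ⟨τ, hτ, by simp⟩
  | insert j s hj ih =>
    obtain ⟨σ, hσ, h⟩ := ih
    -- Exchanging the current partner of `p j` with `q j` creates the new pair; injectivity and
    -- disjointness of `p` and `q` keep the earlier pairs intact.
    refine ⟨switch (σ (p j)) (q j) σ, hσ.switch _ _, fun i hi => ?_⟩
    rcases Finset.mem_insert.mp hi with rfl | hi
    · rw [switch_apply, Equiv.swap_apply_of_ne_of_ne (hσ _).1.symm (hpq _ _),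
        Equiv.swap_apply_left]
    · have hij : i ≠ j := fun h' => hj (h' ▸ hi)
      have h1 : p i ≠ σ (p j) := fun h' => by
        have := congrArg σ h'
        rw [h i hi, (hσ _).2] at this
        exact hpq _ _ this.symm
      rw [switch_apply, Equiv.swap_apply_of_ne_of_ne h1 (hpq _ _), h i hi,
        Equiv.swap_apply_of_ne_of_ne]
      · intro h'
        apply hij
        apply hp
        apply σ.injective
        rw [h i hi, h']
      · exact fun h' => hij (hq h')

/-! ### Random matchings with prescribed pairs -/

variable [Fintype V]

/-- The perfect matchings that agree with `τ` on `A`. -/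
def matchings (A : Finset V) (τ : Equiv.Perm V) : Finset (Equiv.Perm V) :=
  open Classical in Finset.univ.filter fun σ => IsMatching σ ∧ ∀ x ∈ A, σ x = τ x

theorem mem_matchings {A : Finset V} {σ : Equiv.Perm V} :
    σ ∈ matchings A τ ↔ IsMatching σ ∧ ∀ x ∈ A, σ x = τ x := by
  simp [matchings]

theorem self_mem_matchings (hτ : IsMatching τ) (A : Finset V) : τ ∈ matchings A τ :=
  mem_matchings.mpr ⟨hτ, fun _ _ => rfl⟩

/-- The reference matching matters only through its pairs on A, so it may be replaced by one in
which a given curve occurs. -/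
theorem matchings_congr {A : Finset V} {σ : Equiv.Perm V} (hσ : σ ∈ matchings A τ) :
    matchings A σ = matchings A τ := by
  ext ρ
  rw [mem_matchings, mem_matchings]
  refine and_congr_right fun _ => forall₂_congr fun x hx => ?_
  rw [(mem_matchings.mp hσ).2 x hx]

theorem card_matchings_pos (hτ : IsMatching τ) (A : Finset V) :
    (0 : ℝ) < (matchings A τ).card := by
  exact_mod_cast Finset.card_pos.mpr ⟨τ, self_mem_matchings hτ A⟩

theorem switch_mem_matchings (hτ : IsMatching τ) {A : Finset V} (hA : ClosedUnder τ A)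
    {a y : V} (hya : y ≠ a) (hyA : y ∉ A) (haA : a ∉ A) {σ : Equiv.Perm V}
    (hσ : σ ∈ matchings (addPair τ a A) τ) :
    switch y (τ a) σ ∈ matchings A τ ∧ switch y (τ a) σ a = y := by
  obtain ⟨h1, h2⟩ := mem_matchings.mp hσ
  have hsa : σ a = τ a := h2 a (by simp [addPair])
  refine ⟨mem_matchings.mpr ⟨h1.switch _ _, fun x hx => ?_⟩, ?_⟩
  · have hσx : σ x = τ x := h2 x (by simp [addPair, hx])
    have hx' : τ x ∈ A := hA x hx
    have hτa := hA.notMem hτ haA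
    rw [switch_apply_of_ne h1, hσx]
    · rintro rfl; exact hyA hx
    · rintro rfl; exact hτa hx
    · intro h'
      apply hyA
      rw [← (h1 y).2, ← h', hσx]; exact hx'
    · intro h'
      apply haA
      rw [← hsa, (h1 a).2] at h'
      rwa [← h']
  · rw [switch_apply, Equiv.swap_apply_of_ne_of_ne hya.symm (hτ a).1.symm, hsa,
      Equiv.swap_apply_right]

/-- Classify the matchings by the partner `y` of `a`, and switch this partner with the one
prescribed by `τ`. -/
theorem sum_matchings (hτ : IsMatching τ) {A : Finset V} (hA : ClosedUnder τ A) {a : V}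
    (ha : a ∉ A) (F : Equiv.Perm V → ℝ) :
    ∑ σ ∈ matchings A τ, F σ =
      ∑ y ∈ (insert a A)ᶜ, ∑ σ ∈ matchings (addPair τ a A) τ, F (switch y (τ a) σ) := by
  have hmaps : ∀ σ ∈ matchings A τ, σ a ∈ (insert a A)ᶜ := by
    intro σ hσ
    obtain ⟨h1, h2⟩ := mem_matchings.mp hσ
    rw [Finset.mem_compl, Finset.mem_insert, not_or]
    refine ⟨(h1 a).1, fun h => ha ?_⟩
    have := hA _ h
    rwa [← h2 _ h, (h1 a).2] at this
  rw [← Finset.sum_fiberwise_of_maps_to hmaps]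
  refine Finset.sum_congr rfl fun y hy => ?_
  rw [Finset.mem_compl, Finset.mem_insert, not_or] at hy
  symm
  refine Finset.sum_bij' (fun σ _ => switch y (τ a) σ) (fun σ _ => switch y (τ a) σ)
    (fun σ hσ => ?_) (fun σ hσ => ?_) (fun σ _ => switch_switch _ _ _)
    (fun σ _ => switch_switch _ _ _) (fun σ _ => rfl)
  · rw [Finset.mem_filter]
    exact switch_mem_matchings hτ hA hy.1 hy.2 ha hσ
  · obtain ⟨hσ, hσa⟩ := Finset.mem_filter.mp hσ
    obtain ⟨h1, h2⟩ := mem_matchings.mp hσ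
    have hτa := hA.notMem hτ ha
    have ha' : switch y (τ a) σ a = τ a := by
      rw [switch_apply, Equiv.swap_apply_of_ne_of_ne (Ne.symm hy.1) (hτ a).1.symm, hσa,
        Equiv.swap_apply_left]
    refine mem_matchings.mpr ⟨h1.switch _ _, fun x hx => ?_⟩
    simp only [addPair, Finset.mem_insert] at hx
    rcases hx with rfl | rfl | hx
    · exact ha'
    · rw [(hτ a).2]
      nth_rewrite 2 [← ha']
      exact ((h1.switch _ _) a).2
    · have hσx := h2 x hx
      rw [switch_apply_of_ne h1, hσx]
      · rintro rfl; exact hy.2 hx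
      · rintro rfl; exact hτa hx
      · intro h'
        apply ha
        rw [← hσa, (h1 a).2] at h'
        rwa [← h']
      · intro h'
        apply hτa
        rw [← (h1 (τ a)).2, ← h', hσx]; exact hA x hx

theorem card_compl_insert {A : Finset V} {a : V} (ha : a ∉ A) :
    (((insert a A)ᶜ).card : ℝ) = Fintype.card V - A.card - 1 := by
  have := Finset.card_add_card_compl (insert a A)
  rw [Finset.card_insert_of_notMem ha] at this
  have h2 : ((A.card + 1 + ((insert a A)ᶜ).card : ℕ) : ℝ) = Fintype.card V := by rw [this]
  push_cast at h2
  linarith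

theorem card_matchings (hτ : IsMatching τ) {A : Finset V} (hA : ClosedUnder τ A) {a : V}
    (ha : a ∉ A) : ((matchings A τ).card : ℝ) =
      (Fintype.card V - A.card - 1) * (matchings (addPair τ a A) τ).card := by
  have := sum_matchings hτ hA ha (fun _ => 1)
  simp only [Finset.sum_const, nsmul_eq_mul, mul_one] at this
  rw [this, card_compl_insert ha]

/-- The average of `F` over the matchings that agree with `τ` on `A`. -/
def avg (A : Finset V) (τ : Equiv.Perm V) (F : Equiv.Perm V → ℝ) : ℝ :=
  (∑ σ ∈ matchings A τ, F σ) / (matchings A τ).card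

theorem avg_mono {A : Finset V} {F G : Equiv.Perm V → ℝ}
    (h : ∀ σ ∈ matchings A τ, F σ ≤ G σ) : avg A τ F ≤ avg A τ G :=
  div_le_div_of_nonneg_right (Finset.sum_le_sum h) (Nat.cast_nonneg _)

theorem avg_add (A : Finset V) (F G : Equiv.Perm V → ℝ) :
    avg A τ (fun σ => F σ + G σ) = avg A τ F + avg A τ G := by
  simp only [avg, Finset.sum_add_distrib, add_div]

theorem avg_sub (A : Finset V) (F G : Equiv.Perm V → ℝ) :
    avg A τ (fun σ => F σ - G σ) = avg A τ F - avg A τ G := by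
  simp only [avg, Finset.sum_sub_distrib, sub_div]

theorem avg_const_mul (A : Finset V) (c : ℝ) (F : Equiv.Perm V → ℝ) :
    avg A τ (fun σ => c * F σ) = c * avg A τ F := by
  simp only [avg, ← Finset.mul_sum, mul_div_assoc]

theorem avg_sum {ι : Type} (A : Finset V) (s : Finset ι) (F : ι → Equiv.Perm V → ℝ) :
    avg A τ (fun σ => ∑ i ∈ s, F i σ) = ∑ i ∈ s, avg A τ (F i) := by
  simp only [avg, Finset.sum_div]
  rw [Finset.sum_comm]

theorem avg_const (hτ : IsMatching τ) (A : Finset V) (c : ℝ) : avg A τ (fun _ => c) = c := by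
  have := card_matchings_pos hτ A
  simp only [avg, Finset.sum_const, nsmul_eq_mul]
  field_simp

theorem abs_avg_le (A : Finset V) (F : Equiv.Perm V → ℝ) :
    |avg A τ F| ≤ avg A τ (fun σ => |F σ|) := by
  rw [avg, avg, abs_div, Nat.abs_cast]
  exact div_le_div_of_nonneg_right (Finset.abs_sum_le_sum_abs _ _) (Nat.cast_nonneg _)

/-- Given the pairs on A, the partner y of a is uniform outside `insert a A`. A matching with
partner y is obtained from one containing the pair {a, τ a} by a switch, which couples the two
conditional laws. -/
theorem avg_eq_sum_switch (hτ : IsMatching τ) {A : Finset V} (hA : ClosedUnder τ A) {a : V}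
    (ha : a ∉ A) (F : Equiv.Perm V → ℝ) :
    avg A τ F = (∑ y ∈ (insert a A)ᶜ, avg (addPair τ a A) τ (fun σ => F (switch y (τ a) σ))) /
      ((insert a A)ᶜ).card := by
  rw [avg, sum_matchings hτ hA ha, card_matchings hτ hA ha, card_compl_insert ha]
  simp only [avg]
  rw [← Finset.sum_div, div_div, mul_comm]

/-- The probability that a random matching agrees with `τ` on `B`, given that it does on `A`. -/
theorem pow_mul_card_matchings_le (hτ : IsMatching τ) {A B : Finset V} (hA : ClosedUnder τ A)
    (hB : ClosedUnder τ B) (hAB : A ⊆ B) (D : ℝ) (hD0 : 0 ≤ D)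
    (hD : D ≤ Fintype.card V - B.card + 1) :
    ∃ e, B.card = A.card + 2 * e ∧
      D ^ e * (matchings B τ).card ≤ (matchings A τ).card := by
  refine closed_induction hτ
    (fun C => ∃ e, C.card = A.card + 2 * e ∧ D ^ e * (matchings C τ).card ≤ (matchings A τ).card)
    hB _ rfl hA hAB ⟨0, by simp⟩ ?_
  rintro C a hC - hCB haB ha ⟨e, he, h⟩
  have hc := card_addPair hτ hC ha
  refine ⟨e + 1, by rw [hc, he]; ring, ?_⟩
  have h1 : ((addPair τ a C).card : ℝ) ≤ B.card := by
    exact_mod_cast Finset.card_le_card (addPair_subset hB hCB haB)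
  rw [hc] at h1
  push_cast at h1
  refine le_trans ?_ h
  -- The new factor is |V| - |C| - 1. It is at least D because C has at least two elements fewer
  -- than B.
  rw [card_matchings hτ hC ha, pow_succ, mul_assoc]
  gcongr
  linarith

theorem card_matchings_empty (hτ : IsMatching τ) {B : Finset V} (hB : ClosedUnder τ B) :
    ∃ e, B.card = 2 * e ∧ ((matchings ∅ τ).card : ℝ) =
      (∏ i ∈ Finset.range e, ((Fintype.card V : ℝ) - 2 * i - 1)) * (matchings B τ).card := by
  refine closed_induction hτ
    (fun C => ∃ e, C.card = 2 * e ∧ ((matchings ∅ τ).card : ℝ) =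
      (∏ i ∈ Finset.range e, ((Fintype.card V : ℝ) - 2 * i - 1)) * (matchings C τ).card)
    hB _ rfl (A := ∅) (fun x hx => absurd hx (by simp)) (by simp) ⟨0, by simp⟩ ?_
  rintro C a hC - - - ha ⟨e, he, h⟩
  refine ⟨e + 1, by rw [card_addPair hτ hC ha, he]; ring, ?_⟩
  rw [h, card_matchings hτ hC ha, Finset.prod_range_succ, he]
  push_cast
  ring

/-- Telescoping over the pairs of a set. -/
theorem abs_avg_empty_sub_le (hτ : IsMatching τ) {B : Finset V} (hB : ClosedUnder τ B)
    (F : Equiv.Perm V → ℝ) (δ : ℝ)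
    (hstep : ∀ C a, ClosedUnder τ C → C ⊆ B → a ∈ B → a ∉ C →
      |avg C τ F - avg (addPair τ a C) τ F| ≤ δ) :
    |avg ∅ τ F - avg B τ F| ≤ B.card * δ := by
  by_cases hB0 : B = ∅
  · simp [hB0]
  have hδ : 0 ≤ δ := by
    obtain ⟨a, ha⟩ := Finset.nonempty_iff_ne_empty.mpr hB0
    exact (abs_nonneg _).trans (hstep ∅ a (fun x hx => absurd hx (by simp)) (by simp) ha (by simp))
  refine closed_induction hτ (fun C => |avg ∅ τ F - avg C τ F| ≤ C.card * δ)
    hB _ rfl (A := ∅) (fun x hx => absurd hx (by simp)) (by simp) (by simp) ?_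
  rintro C a hC - hCB haB ha h
  have := hstep C a hC hCB haB ha
  rw [card_addPair hτ hC ha]
  have h3 := abs_add_le (avg ∅ τ F - avg C τ F) (avg C τ F - avg (addPair τ a C) τ F)
  rw [sub_add_sub_cancel] at h3
  push_cast
  nlinarith

end Matching

/-! ### Cyclic sequences of passages -/

section Curves

variable {N : ℕ}

/-- The triangle that contains a side. -/
def triangle (x : Label N) : Fin (2 * N) := ⟨x.val / 3, by have := x.2; omega⟩

theorem Passage.triangle_eq (p : Passage N) : triangle p.1.1 = triangle p.1.2 :=
  Fin.ext p.2.2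

theorem Passage.ext_sides {p q : Passage N} (h1 : p.1.1 = q.1.1) (h2 : p.1.2 = q.1.2) : p = q :=
  Subtype.ext (Prod.ext h1 h2)

variable {k l : ℕ}

/-- The cyclic sequence of passages `s` occurs in the surface glued according to `σ`. -/
def Occurs (σ : Equiv.Perm (Label N)) (s : ZMod k → Passage N) : Prop :=
  ∀ i, σ (s i).1.2 = (s (i + 1)).1.1

/-- No nontrivial rotation fixes the cyclic sequence. -/
def CyclicPrimitive {A : Type} (s : ZMod k → A) : Prop := ∀ j ≠ 0, (fun i => s (i + j)) ≠ s

/-- The passages lie in pairwise distinct triangles. -/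
def Simple (s : ZMod k → Passage N) : Prop := Function.Injective fun i => triangle (s i).1.1

/-- The reversed cyclic sequence. -/
def reversed (s : ZMod k → Passage N) : ZMod k → Passage N := fun i => (s (-i)).flip

theorem Occurs.reverse {σ : Equiv.Perm (Label N)} (hσ : IsMatching σ) {s : ZMod k → Passage N}
    (h : Occurs σ s) : Occurs σ (reversed s) := by
  intro i
  have := h (-i - 1)
  simp only [reversed, Passage.flip]
  rw [show -(i + 1) = -i - 1 by ring, show (s (-i)).1.1 = σ (s (-i - 1)).1.2 by
    rw [this, sub_add_cancel], (hσ _).2]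

theorem Occurs.apply_entry {σ : Equiv.Perm (Label N)} (hσ : IsMatching σ)
    {s : ZMod k → Passage N} (h : Occurs σ s) (i : ZMod k) :
    σ (s i).1.1 = (s (i - 1)).1.2 := by
  have := h (i - 1)
  rw [sub_add_cancel] at this
  rw [← this, (hσ _).2]

/-- A curve cannot be its own reversal. The reflection i ↦ c - i has a fixed index r or exchanges
some r and r + 1, according to the parity of the representative of c. In the first case a passage
has equal entry and exit; in the second a side is glued to itself. -/
theorem not_occurs_of_eq_flip [NeZero k] {σ : Equiv.Perm (Label N)} (hσ : IsMatching σ)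
    {s : ZMod k → Passage N} (h : Occurs σ s) (c : ZMod k) (hc : ∀ i, s i = (s (c - i)).flip) :
    False := by
  have hval : ((c.val : ℕ) : ZMod k) = c := ZMod.natCast_zmod_val c
  obtain ⟨r, hr | hr⟩ := Nat.even_or_odd' c.val
  · have h1 : c - (r : ZMod k) = r := by rw [← hval, hr]; push_cast; ring
    have := hc r
    rw [h1] at this
    exact (s r).2.1 (congrArg (fun p : Passage N => p.1.1) this)
  · have h1 : c - (r : ZMod k) = r + 1 := by rw [← hval, hr]; push_cast; ring
    have := hc r
    rw [h1] at this
    have h2 : (s r).1.2 = (s (r + 1)).1.1 := congrArg (fun p : Passage N => p.1.2) this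
    rw [← h r] at h2
    exact (hσ _).1 h2.symm

theorem forall_of_forall_add_natCast [NeZero k] {P : ZMod k → Prop} (i : ZMod k)
    (h : ∀ n : ℕ, P (i + n)) (j : ZMod k) : P j := by
  have := h (j - i).val
  rwa [ZMod.natCast_zmod_val, add_sub_cancel] at this

/-- Every triangle contains at most two elements of `U`. -/
def AtMostTwo (U : Finset (Label N)) : Prop :=
  ∀ x ∈ U, ∀ y ∈ U, ∀ z ∈ U, triangle x = triangle y → triangle y = triangle z →
    x = y ∨ y = z ∨ x = z

theorem Simple.cyclicPrimitive {s : ZMod k → Passage N} (hs : Simple s) : CyclicPrimitive s := by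
  intro j hj h
  have := congrFun h 0
  apply hj
  have := hs (a₁ := 0 + j) (a₂ := 0) (by simp only [this])
  simpa using this

theorem Simple.reverse {s : ZMod k → Passage N} (hs : Simple s) : Simple (reversed s) := by
  intro i j hij
  have : triangle (s (-i)).1.1 = triangle (s (-j)).1.1 := by
    rw [(s (-i)).triangle_eq, (s (-j)).triangle_eq]; exact hij
  exact neg_injective (hs this)

/-- Rotating s' by k fixes it, so primitivity gives l ∣ k; going l steps along s returns to the same
triangle, so simplicity gives k ∣ l. -/
theorem eq_card_of_shift [NeZero l] {s : ZMod k → Passage N} {s' : ZMod l → Passage N}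
    (hs : Simple s) (hs' : CyclicPrimitive s') (i : ZMod k)
    (h : ∀ n : ℕ, s' n = s (i + n)) : l = k := by
  apply Nat.dvd_antisymm
  · rw [← ZMod.natCast_eq_zero_iff]
    by_contra hne
    refine hs' _ hne (funext fun m => ?_)
    have h1 := h (m.val + k)
    have h2 := h m.val
    push_cast at h1
    rw [ZMod.natCast_self, add_zero, ← h2, ZMod.natCast_zmod_val] at h1
    exact h1
  · rw [← ZMod.natCast_eq_zero_iff]
    have h1 := h l
    have h2 := h 0
    rw [ZMod.natCast_self] at h1
    rw [Nat.cast_zero, h1] at h2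
    have := hs (a₁ := i + l) (a₂ := i + ((0 : ℕ) : ZMod k)) (by simp only [h2])
    simpa using this

/-! ### Sides and triangles met by a curve: rigidity and counting -/

section Labels

variable [NeZero k] [NeZero l]

/-- The sides crossed by the curve. -/
def labels (s : ZMod k → Passage N) : Finset (Label N) :=
  Finset.univ.image (fun i => (s i).1.1) ∪ Finset.univ.image (fun i => (s i).1.2)

/-- The triangles crossed by the curve. -/
def triangles (s : ZMod k → Passage N) : Finset (Fin (2 * N)) :=
  Finset.univ.image fun i => triangle (s i).1.1

theorem mem_labels {s : ZMod k → Passage N} {x : Label N} :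
    x ∈ labels s ↔ ∃ i, (s i).1.1 = x ∨ (s i).1.2 = x := by
  simp [labels, exists_or]

theorem entry_mem_labels (s : ZMod k → Passage N) (i : ZMod k) : (s i).1.1 ∈ labels s :=
  mem_labels.mpr ⟨i, Or.inl rfl⟩

theorem exit_mem_labels (s : ZMod k → Passage N) (i : ZMod k) : (s i).1.2 ∈ labels s :=
  mem_labels.mpr ⟨i, Or.inr rfl⟩

theorem card_labels_le (s : ZMod k → Passage N) : (labels s).card ≤ 2 * k := by
  refine (Finset.card_union_le _ _).trans ?_
  have h1 := Finset.card_image_le (s := Finset.univ) (f := fun i => (s i).1.1)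
  have h2 := Finset.card_image_le (s := Finset.univ) (f := fun i => (s i).1.2)
  rw [Finset.card_univ, ZMod.card] at h1 h2
  omega

theorem card_triangles_le (s : ZMod k → Passage N) : (triangles s).card ≤ k := by
  have h1 := Finset.card_image_le (s := Finset.univ) (f := fun i => triangle (s i).1.1)
  rwa [Finset.card_univ, ZMod.card] at h1

theorem triangle_mem_triangles {s : ZMod k → Passage N} {x : Label N} (hx : x ∈ labels s) :
    triangle x ∈ triangles s := by
  obtain ⟨i, rfl | rfl⟩ := mem_labels.mp hx
  · exact Finset.mem_image_of_mem _ (Finset.mem_univ i)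
  · rw [← Passage.triangle_eq]
    exact Finset.mem_image_of_mem (fun i => triangle (s i).1.1) (Finset.mem_univ i)

theorem labels_reverse (s : ZMod k → Passage N) : labels (reversed s) = labels s := by
  ext x
  rw [mem_labels, mem_labels]
  constructor
  · rintro ⟨i, h⟩; exact ⟨-i, h.symm⟩
  · rintro ⟨i, h⟩; exact ⟨-i, by simpa [reversed, Passage.flip] using h.symm⟩

theorem Occurs.closedUnder {σ : Equiv.Perm (Label N)} (hσ : IsMatching σ)
    {s : ZMod k → Passage N} (h : Occurs σ s) : ClosedUnder σ (labels s) := by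
  intro x hx
  obtain ⟨i, rfl | rfl⟩ := mem_labels.mp hx
  · rw [h.apply_entry hσ]; exact exit_mem_labels _ _
  · rw [h]; exact entry_mem_labels _ _

theorem Occurs.iff_eqOn {σ τ : Equiv.Perm (Label N)} (hσ : IsMatching σ) (hτ : IsMatching τ)
    {s : ZMod k → Passage N} (h : Occurs τ s) : Occurs σ s ↔ ∀ x ∈ labels s, σ x = τ x := by
  constructor
  · intro h' x hx
    obtain ⟨i, rfl | rfl⟩ := mem_labels.mp hx
    · rw [h.apply_entry hτ, h'.apply_entry hσ]
    · rw [h, h']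
  · intro h' i
    rw [h' _ (exit_mem_labels _ _), h]

/-- In a set with at most two sides per triangle, a passage determines the following ones. -/
theorem Occurs.eq_of_eq {σ : Equiv.Perm (Label N)} {U : Finset (Label N)} (hU : AtMostTwo U)
    {s : ZMod k → Passage N} {s' : ZMod l → Passage N} (h : Occurs σ s) (h' : Occurs σ s')
    (hs : labels s ⊆ U) (hs' : labels s' ⊆ U) {i : ZMod k} {j : ZMod l} (hij : s i = s' j)
    (n : ℕ) : s (i + n) = s' (j + n) := by
  induction n with
  | zero => simpa using hij
  | succ n ih =>
    push_cast
    rw [← add_assoc, ← add_assoc]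
    have h1 : (s (i + n + 1)).1.1 = (s' (j + n + 1)).1.1 := by rw [← h, ← h', ih]
    refine Passage.ext_sides h1 ?_
    have h2 := (s (i + n + 1)).triangle_eq
    have h3 := (s' (j + n + 1)).triangle_eq
    rcases hU _ (hs (exit_mem_labels s (i + n + 1))) _ (hs (entry_mem_labels s (i + n + 1)))
      _ (hs' (exit_mem_labels s' (j + n + 1))) h2.symm (by rw [h1, h3]) with h4 | h4 | h4
    · exact absurd h4.symm (s (i + n + 1)).2.1
    · rw [h1] at h4
      exact absurd h4 (s' (j + n + 1)).2.1
    · exact h4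

/-- With at most two sides per triangle available, a triangle admits only one passage up to
direction. -/
theorem Passage.eq_or_eq_flip {U : Finset (Label N)} (hU : AtMostTwo U) {p q : Passage N}
    (hp1 : p.1.1 ∈ U) (hp2 : p.1.2 ∈ U) (hq1 : q.1.1 ∈ U) (hq2 : q.1.2 ∈ U)
    (h : triangle p.1.1 = triangle q.1.1) : p = q ∨ p = q.flip := by
  have hp := p.triangle_eq
  have hq := q.triangle_eq
  rcases hU _ hp1 _ hq1 _ hq2 h hq with h1 | h1 | h1
  · left
    refine Passage.ext_sides h1 ?_
    rcases hU _ hp2 _ hq1 _ hq2 (by rw [← hp, h]) hq with h2 | h2 | h2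
    · exact absurd (h1.trans h2.symm) p.2.1
    · exact absurd h2 q.2.1
    · exact h2
  · exact absurd h1 q.2.1
  · right
    refine Passage.ext_sides h1 ?_
    rcases hU _ hp2 _ hq1 _ hq2 (by rw [← hp, h]) hq with h2 | h2 | h2
    · exact h2
    · exact absurd h2 q.2.1
    · exact absurd (h1.trans h2.symm) p.2.1

/-- A primitive curve with at most two sides per triangle is simple. -/
theorem Occurs.simple_of_atMostTwo {σ : Equiv.Perm (Label N)} (hσ : IsMatching σ)
    {s : ZMod k → Passage N} (h : Occurs σ s) (hp : CyclicPrimitive s)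
    (hU : AtMostTwo (labels s)) : Simple s := by
  intro i j hij
  by_contra hne
  -- Two passages through one triangle are equal or opposite. Following the curve from there, the
  -- first case yields a nontrivial rotation fixing s; the second makes s its own reversal.
  rcases Passage.eq_or_eq_flip hU (entry_mem_labels s i) (exit_mem_labels s i)
    (entry_mem_labels s j) (exit_mem_labels s j) hij with he | he
  · have h1 := h.eq_of_eq hU h subset_rfl subset_rfl he
    refine hp (j - i) (sub_ne_zero.mpr (Ne.symm hne)) (funext fun m => ?_)
    refine forall_of_forall_add_natCast (P := fun m => s (m + (j - i)) = s m) i (fun n => ?_) m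
    rw [h1 n]
    congr 1
    ring
  · have he' : s i = reversed s (-j) := by simpa [reversed] using he
    have h1 := h.eq_of_eq hU (h.reverse hσ) subset_rfl (labels_reverse s).subset he'
    refine not_occurs_of_eq_flip hσ h (i + j) fun m => ?_
    refine forall_of_forall_add_natCast (P := fun m => s m = (s (i + j - m)).flip) i
      (fun n => ?_) m
    rw [h1 n]
    simp only [reversed]
    congr 2
    ring

theorem Simple.atMostTwo {s : ZMod k → Passage N} (hs : Simple s) : AtMostTwo (labels s) := by
  intro x hx y hy z hz hxy hyz
  obtain ⟨a, ha⟩ := mem_labels.mp hx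
  obtain ⟨b, hb⟩ := mem_labels.mp hy
  obtain ⟨c, hc⟩ := mem_labels.mp hz
  have ht : ∀ {x : Label N} {a : ZMod k}, ((s a).1.1 = x ∨ (s a).1.2 = x) →
      triangle (s a).1.1 = triangle x := by
    rintro x a (rfl | rfl)
    · rfl
    · exact (s a).triangle_eq
  have hab : a = b := hs (by simpa only [ht ha, ht hb] using hxy)
  have hbc : b = c := hs (by simpa only [ht hb, ht hc] using hyz)
  subst hab; subst hbc
  rcases ha with ha | ha <;> rcases hb with hb | hb <;> rcases hc with hc | hc <;>
    simp_all

/-- A primitive curve whose sides all belong to a simple curve runs along this curve. -/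
theorem Simple.shift_of_labels_subset {σ : Equiv.Perm (Label N)} (hσ : IsMatching σ)
    {s : ZMod k → Passage N} {s' : ZMod l → Passage N} (hs : Simple s) (h : Occurs σ s)
    (hs' : CyclicPrimitive s') (h' : Occurs σ s') (hsub : labels s' ⊆ labels s) :
    l = k ∧ ∃ i : ZMod k, (∀ n : ℕ, s' n = s (i + n)) ∨
      (∀ n : ℕ, s' n = reversed s (i + n)) := by
  obtain ⟨i, hi⟩ : ∃ i, triangle (s' 0).1.1 = triangle (s i).1.1 := by
    have := triangle_mem_triangles (hsub (entry_mem_labels s' 0))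
    obtain ⟨i, -, hi⟩ := Finset.mem_image.mp this
    exact ⟨i, hi.symm⟩
  rcases Passage.eq_or_eq_flip hs.atMostTwo (hsub (entry_mem_labels s' 0))
    (hsub (exit_mem_labels s' 0)) (entry_mem_labels s i) (exit_mem_labels s i) hi with he | he
  · have h1 : ∀ n : ℕ, s' n = s (i + n) := fun n => by
      simpa using h'.eq_of_eq hs.atMostTwo h hsub subset_rfl he n
    exact ⟨eq_card_of_shift hs hs' i h1, i, Or.inl h1⟩
  · have he' : s' 0 = reversed s (-i) := by simpa [reversed] using he
    have h1 : ∀ n : ℕ, s' n = reversed s (-i + n) := fun n => by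
      simpa using h'.eq_of_eq hs.atMostTwo (h.reverse hσ) hsub (labels_reverse s).subset he' n
    exact ⟨eq_card_of_shift hs.reverse hs' (-i) h1, -i, Or.inr h1⟩

theorem two_mul_card_le {U : Finset (Label N)} {T : Finset (Fin (2 * N))}
    (h : ∀ t ∈ T, ∃ x ∈ U, ∃ y ∈ U, x ≠ y ∧ triangle x = t ∧ triangle y = t) :
    2 * T.card ≤ U.card := by
  have h1 : ∀ t ∈ T, 2 ≤ (U.filter fun x => triangle x = t).card := by
    intro t ht
    obtain ⟨x, hx, y, hy, hxy, hxt, hyt⟩ := h t ht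
    refine (Finset.card_pair hxy).symm.le.trans ?_
    refine Finset.card_le_card fun z hz => ?_
    rw [Finset.mem_insert, Finset.mem_singleton] at hz
    rcases hz with rfl | rfl <;> simp [*]
  calc 2 * T.card = ∑ t ∈ T, 2 := by simp [mul_comm]
    _ ≤ ∑ t ∈ T, (U.filter fun x => triangle x = t).card := Finset.sum_le_sum h1
    _ ≤ ∑ t, (U.filter fun x => triangle x = t).card :=
        Finset.sum_le_sum_of_subset (Finset.subset_univ T)
    _ = U.card := (Finset.card_eq_sum_card_fiberwise fun x _ => by simp).symm

theorem ClosedUnder.union {σ : Equiv.Perm (Label N)} {A B : Finset (Label N)}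
    (hA : ClosedUnder σ A) (hB : ClosedUnder σ B) : ClosedUnder σ (A ∪ B) := by
  intro x hx
  rcases Finset.mem_union.mp hx with h | h
  · exact Finset.mem_union_left _ (hA x h)
  · exact Finset.mem_union_right _ (hB x h)

/-- If an additional side is used, then the curve uses more new pairs than new triangles. -/
theorem Occurs.card_union_ge {σ : Equiv.Perm (Label N)} (hσ : IsMatching σ)
    {A : Finset (Label N)} (hA : ClosedUnder σ A) {T₀ : Finset (Fin (2 * N))}
    (hT₀ : ∀ x ∈ A, triangle x ∈ T₀) {s : ZMod k → Passage N} (h : Occurs σ s)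
    {x : Label N} (hx : x ∈ labels s) (hxA : x ∉ A)
    (hT : ∀ i, triangle (s i).1.1 ∉ T₀ → ∃ y ∈ labels s, ∃ z ∈ labels s,
      y ≠ x ∧ z ≠ x ∧ y ≠ z ∧ triangle y = triangle (s i).1.1 ∧
        triangle z = triangle (s i).1.1) :
    A.card + 2 * ((triangles s \ T₀).card + 1) ≤ (A ∪ labels s).card := by
  have h1 : 2 * (triangles s \ T₀).card ≤ ((labels s \ A).erase x).card := by
    refine two_mul_card_le fun t ht => ?_
    obtain ⟨ht1, ht2⟩ := Finset.mem_sdiff.mp ht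
    obtain ⟨i, -, rfl⟩ := Finset.mem_image.mp ht1
    obtain ⟨y, hy, z, hz, hyx, hzx, hyz, hyt, hzt⟩ := hT i ht2
    refine ⟨y, ?_, z, ?_, hyz, hyt, hzt⟩
    · refine Finset.mem_erase.mpr ⟨hyx, Finset.mem_sdiff.mpr ⟨hy, fun hyA => ht2 ?_⟩⟩
      rw [← hyt]; exact hT₀ y hyA
    · refine Finset.mem_erase.mpr ⟨hzx, Finset.mem_sdiff.mpr ⟨hz, fun hzA => ht2 ?_⟩⟩
      rw [← hzt]; exact hT₀ z hzA
  have h2 := Finset.card_erase_add_one (Finset.mem_sdiff.mpr ⟨hx, hxA⟩)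
  have h3 : (A ∪ labels s).card = A.card + (labels s \ A).card := by
    rw [← Finset.card_union_of_disjoint Finset.disjoint_sdiff, Finset.union_sdiff_self_eq_union]
  -- With t new triangles there are at least 2t + 1 new sides, and their number is even, so there
  -- are at least 2t + 2.
  obtain ⟨e, he⟩ := ClosedUnder.even_card_sdiff hσ (hA.union (h.closedUnder hσ)) hA
    Finset.subset_union_left
  omega

/-- A primitive curve that is not simple uses more pairs than triangles. -/
theorem Occurs.card_ge_of_not_simple {σ : Equiv.Perm (Label N)} (hσ : IsMatching σ)
    {s : ZMod k → Passage N} (h : Occurs σ s) (hp : CyclicPrimitive s) (hs : ¬ Simple s) :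
    (∅ : Finset (Label N)).card + 2 * ((triangles s \ ∅).card + 1) ≤ (∅ ∪ labels s).card := by
  have : ¬ AtMostTwo (labels s) := fun h' => hs (h.simple_of_atMostTwo hσ hp h')
  unfold AtMostTwo at this
  push Not at this
  -- All three sides of a triangle are used: x is the additional side, while y and z remain to
  -- account for that triangle.
  obtain ⟨x, hx, y, hy, z, hz, hxy, hyz, h1, h2, h3⟩ := this
  refine h.card_union_ge hσ (fun x hx => absurd hx (by simp)) (fun x hx => absurd hx (by simp))
    hx (by simp) fun i _ => ?_
  by_cases hi : triangle (s i).1.1 = triangle x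
  · exact ⟨y, hy, z, hz, h1.symm, h3.symm, h2, by rw [hi, hxy], by rw [hi, hxy, hyz]⟩
  · refine ⟨_, entry_mem_labels s i, _, exit_mem_labels s i, ?_, ?_, (s i).2.1, rfl,
      (s i).triangle_eq.symm⟩
    · rintro rfl; exact hi rfl
    · rintro rfl; exact hi (s i).triangle_eq

/-- A primitive curve through a given side `x` that is not a given simple curve `α` uses more new
pairs than new triangles, even if part of `α` is known to occur. -/
theorem Occurs.card_ge_of_mem_labels {σ τ : Equiv.Perm (Label N)} (hσ : IsMatching σ)
    (hτ : IsMatching τ) {α : ZMod k → Passage N} (hα : Simple α) (hατ : Occurs τ α)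
    {A : Finset (Label N)} (hA : ClosedUnder τ A) (hAα : A ⊆ labels α)
    (hστ : ∀ x ∈ A, σ x = τ x) {s : ZMod l → Passage N} (h : Occurs σ s)
    (hp : CyclicPrimitive s) {x : Label N} (hx : x ∈ labels s)
    (hne : ¬ (l = k ∧ ∃ i : ZMod k, (∀ n : ℕ, s n = α (i + n)) ∨
      (∀ n : ℕ, s n = reversed α (i + n)))) :
    A.card + 2 * ((triangles s \ insert (triangle x) (triangles α)).card + 1) ≤
      (A ∪ labels s).card := by
  have hAσ : ClosedUnder σ A := fun y hy => by rw [hστ y hy]; exact hA y hy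
  -- A side outside A in an already counted triangle serves as the additional one. If there were
  -- none, s would contain x ∈ A and could never leave A: an entry in A forces an exit in the same
  -- triangle of α, hence in A, and partners stay in A. Then all sides of s would belong to α, so s
  -- would run along α.
  obtain ⟨y, hy, hyA, hyT⟩ : ∃ y ∈ labels s, y ∉ A ∧
      triangle y ∈ insert (triangle x) (triangles α) := by
    by_cases hxA : x ∈ A
    swap
    · exact ⟨x, hx, hxA, by simp⟩
    by_contra hno
    push Not at hno
    have hno' : ∀ y ∈ labels s, triangle y ∈ triangles α → y ∈ A := by
      intro y hy hyT
      by_contra hyA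
      exact hno y hy hyA (Finset.mem_insert_of_mem hyT)
    have hexit : ∀ i, (s i).1.1 ∈ A → (s i).1.2 ∈ A := fun i hi =>
      hno' _ (exit_mem_labels s i) (by
        rw [← Passage.triangle_eq]; exact triangle_mem_triangles (hAα hi))
    have hnext : ∀ i, (s i).1.2 ∈ A → (s (i + 1)).1.1 ∈ A := fun i hi => by
      rw [← h]; exact hAσ _ hi
    obtain ⟨i, hi⟩ : ∃ i, (s i).1.1 ∈ A := by
      obtain ⟨i, rfl | rfl⟩ := mem_labels.mp hx
      · exact ⟨i, hxA⟩
      · exact ⟨i + 1, hnext i hxA⟩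
    have hall : ∀ j, (s j).1.1 ∈ A := by
      refine forall_of_forall_add_natCast i fun n => ?_
      induction n with
      | zero => simpa using hi
      | succ n ih =>
        push_cast
        rw [← add_assoc]
        exact hnext _ (hexit _ ih)
    have hsub : labels s ⊆ A := by
      intro y hy
      obtain ⟨j, rfl | rfl⟩ := mem_labels.mp hy
      · exact hall j
      · exact hexit j (hall j)
    have hsτ : Occurs τ s := fun j => by
      rw [← hστ _ (hsub (exit_mem_labels s j)), h]
    exact hne (hα.shift_of_labels_subset hτ hατ hp hsτ (hsub.trans hAα))
  refine h.card_union_ge hσ hAσ (fun z hz => Finset.mem_insert_of_mem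
    (triangle_mem_triangles (hAα hz))) hy hyA fun i hi => ?_
  refine ⟨_, entry_mem_labels s i, _, exit_mem_labels s i, ?_, ?_, (s i).2.1, rfl,
    (s i).triangle_eq.symm⟩
  · rintro rfl; exact hi hyT
  · rintro rfl; rw [Passage.triangle_eq] at hi; exact hi hyT

end Labels

end Curves

/-! ### Cyclic sequences and lists -/

section CyclicLists

variable {A : Type} {k : ℕ}

/-- The list of the values of a cyclic sequence. -/
def toList (s : ZMod k → A) : List A := List.ofFn fun i : Fin k => s (i.val : ZMod k)

theorem length_toList (s : ZMod k → A) : (toList s).length = k := by simp [toList]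

theorem getElem_toList (s : ZMod k → A) (n : ℕ) (h : n < (toList s).length) :
    (toList s)[n] = s n := by simp [toList]

theorem reverse_map_toList (f : A → A) (s : ZMod k → A) :
    ((toList s).map f).reverse = toList fun i => f (s (-1 - i)) := by
  refine List.ext_getElem (by simp [length_toList]) fun m h1 h2 => ?_
  rw [List.getElem_reverse, List.getElem_map, getElem_toList, getElem_toList]
  rw [length_toList] at h2
  congr 2
  rw [List.length_map, length_toList, Nat.sub_sub, Nat.cast_sub (by omega)]
  push_cast
  rw [ZMod.natCast_self]
  ring

theorem rotate_toList (s : ZMod k → A) (n : ℕ) :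
    (toList s).rotate n = toList fun i : ZMod k => s (i + (n : ZMod k)) := by
  refine List.ext_getElem (by simp [length_toList]) fun m h1 h2 => ?_
  rw [List.getElem_rotate, getElem_toList, getElem_toList, length_toList, ZMod.natCast_mod]
  push_cast
  rfl

variable [NeZero k]

theorem toList_injective : Function.Injective (toList : (ZMod k → A) → List A) := by
  intro s s' h
  have h1 := List.ofFn_injective h
  funext i
  have := congrFun h1 ⟨i.val, ZMod.val_lt i⟩
  simpa [ZMod.natCast_zmod_val] using this

theorem exists_toList_eq (l : List A) (h : l.length = k) : ∃ s : ZMod k → A, toList s = l := by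
  refine ⟨fun i => l[i.val]'(by rw [h]; exact ZMod.val_lt i), ?_⟩
  refine List.ext_getElem (by rw [length_toList, h]) fun n h1 h2 => ?_
  rw [getElem_toList]
  congr 1
  rw [h] at h2
  exact ZMod.val_natCast_of_lt h2

theorem toList_isRotated_iff (s s' : ZMod k → A) :
    toList s ~r toList s' ↔ ∃ j, ∀ i, s' i = s (i + j) := by
  constructor
  · rintro ⟨n, hn⟩
    rw [rotate_toList] at hn
    exact ⟨n, fun i => (congrFun (toList_injective hn) i).symm⟩
  · rintro ⟨j, hj⟩
    refine ⟨j.val, ?_⟩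
    rw [rotate_toList, ZMod.natCast_zmod_val]
    congr 1
    exact (funext hj).symm

theorem cyclicRevSetoid_toList_iff (f : A → A) (hf : Function.Involutive f) (s s' : ZMod k → A) :
    (cyclicRevSetoid f hf).r (toList s) (toList s') ↔
      (∃ j, ∀ i, s' i = s (i + j)) ∨ ∃ j, ∀ i, s' i = f (s (j - i)) := by
  change (toList s ~r toList s' ∨ toList s ~r ((toList s').map f).reverse) ↔ _
  rw [reverse_map_toList, toList_isRotated_iff, toList_isRotated_iff]
  refine or_congr_right ⟨?_, ?_⟩
  · rintro ⟨j, hj⟩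
    refine ⟨j - 1, fun i => ?_⟩
    have := hj (-1 - i)
    rw [sub_sub_cancel] at this
    rw [← hf (s' i), this]
    congr 2
    ring
  · rintro ⟨j, hj⟩
    refine ⟨j + 1, fun i => ?_⟩
    rw [hj, hf]
    congr 1
    ring

theorem cycle_chain_toList_iff (r : A → A → Prop) (s : ZMod k → A) :
    Cycle.Chain r (toList s : Cycle A) ↔ ∀ i, r (s i) (s (i + 1)) := by
  have hk : 0 < k := Nat.pos_of_ne_zero (NeZero.ne k)
  obtain ⟨a, l, hal⟩ : ∃ a l, toList s = a :: l :=
    List.exists_cons_of_ne_nil (List.ne_nil_of_length_pos (by rwa [length_toList]))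
  have hlen : l.length + 1 = k := by
    have := length_toList s
    rwa [hal, List.length_cons] at this
  have ha : a = s 0 := by
    have := getElem_toList s 0 (by rwa [length_toList])
    simpa [hal] using this
  have hget : ∀ n (hn : n < (a :: (l ++ [a])).length), (a :: (l ++ [a]))[n] = s n := by
    intro n hn
    simp only [List.length_cons, List.length_append, List.length_nil] at hn
    by_cases h : n < k
    · have h1 := getElem_toList s n (by rwa [length_toList])
      rw [← h1]
      simp only [hal, ← List.cons_append]
      rw [List.getElem_append_left]
    · have h2 : n = k := by omega
      have h3 : (n : ZMod k) = 0 := by rw [h2, ZMod.natCast_self]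
      rw [h3, ← ha]
      simp only [← List.cons_append]
      rw [List.getElem_append_right (by simp; omega)]
      simp
  rw [hal, Cycle.chain_coe_cons, List.isChain_iff_getElem]
  constructor
  · intro h i
    have hi := ZMod.val_lt i
    have := h i.val (by simp; omega)
    rw [hget, hget] at this
    push_cast at this
    rwa [ZMod.natCast_zmod_val] at this
  · intro h n hn
    rw [hget, hget]
    push_cast
    exact h n

theorem toList_primitive_iff (s : ZMod k → A) :
    (∀ j : ℕ, 0 < j → j < (toList s).length → (toList s).rotate j ≠ toList s) ↔
      CyclicPrimitive s := by
  rw [length_toList]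
  constructor
  · intro h j hj he
    refine h j.val (Nat.pos_of_ne_zero fun h0 => hj ((ZMod.val_eq_zero j).mp h0))
      (ZMod.val_lt j) ?_
    rw [rotate_toList, ZMod.natCast_zmod_val, he]
  · intro h j h0 hk he
    rw [rotate_toList] at he
    refine h j (fun hj => ?_) (toList_injective he)
    have := congrArg ZMod.val hj
    rw [ZMod.val_natCast_of_lt hk, ZMod.val_zero] at this
    omega

end CyclicLists

/-! ### Gluings and matchings -/

section Gluings

variable {N : ℕ}

theorem exists_matching_of_gluing (ω : Gluing N) : ∃ σ : Equiv.Perm (Label N),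
    IsMatching σ ∧ ∀ x y, ({x, y} : Finset (Label N)) ∈ ω.1.parts ↔ σ x = y := by
  have h1 : ∀ x, ∃ y, ({x, y} : Finset (Label N)) ∈ ω.1.parts ∧ y ≠ x := by
    intro x
    obtain ⟨p, ⟨hp, hxp⟩, -⟩ := ω.1.existsUnique_mem (Finset.mem_univ x)
    obtain ⟨a, b, hab, rfl⟩ := Finset.card_eq_two.mp (ω.2 p hp)
    rw [Finset.mem_insert, Finset.mem_singleton] at hxp
    rcases hxp with rfl | rfl
    · exact ⟨b, hp, hab.symm⟩
    · exact ⟨a, by rwa [Finset.pair_comm], hab⟩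
  choose f hf hne using h1
  have h2 : ∀ x y, ({x, y} : Finset (Label N)) ∈ ω.1.parts → f x = y := by
    intro x y h
    have := ω.1.eq_of_mem_parts h (hf x) (a := x) (by simp) (by simp)
    have hfx : f x ∈ ({x, y} : Finset (Label N)) := by rw [this]; simp
    simpa [hne x] using hfx
  have hff : Function.Involutive f := fun x => h2 _ _ (by rw [Finset.pair_comm]; exact hf x)
  refine ⟨hff.toPerm f, fun x => ⟨hne x, hff x⟩, fun x y => ⟨h2 x y, ?_⟩⟩
  intro h
  rw [← h]
  exact hf x

/-- The matching that corresponds to a gluing. -/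
def matchingOf (ω : Gluing N) : Equiv.Perm (Label N) := (exists_matching_of_gluing ω).choose

theorem isMatching_matchingOf (ω : Gluing N) : IsMatching (matchingOf ω) :=
  (exists_matching_of_gluing ω).choose_spec.1

theorem pair_mem_parts_iff (ω : Gluing N) (x y : Label N) :
    ({x, y} : Finset (Label N)) ∈ ω.1.parts ↔ matchingOf ω x = y :=
  (exists_matching_of_gluing ω).choose_spec.2 x y

theorem matchingOf_injective : Function.Injective (matchingOf (N := N)) := by
  have key : ∀ ω ω' : Gluing N, matchingOf ω = matchingOf ω' → ω.1.parts ⊆ ω'.1.parts := by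
    intro ω ω' h p hp
    obtain ⟨a, b, hab, rfl⟩ := Finset.card_eq_two.mp (ω.2 p hp)
    rw [pair_mem_parts_iff] at hp ⊢
    rw [← h, hp]
  intro ω ω' h
  exact Subtype.ext (Finpartition.ext ((key ω ω' h).antisymm (key ω' ω h.symm)))

theorem exists_matchingOf_eq {σ : Equiv.Perm (Label N)} (hσ : IsMatching σ) :
    ∃ ω : Gluing N, matchingOf ω = σ := by
  set parts : Finset (Finset (Label N)) := Finset.univ.image fun x => {x, σ x} with hparts
  have hP : ∀ p ∈ parts, ∀ x ∈ p, p = {x, σ x} := by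
    intro p hp x hx
    obtain ⟨y, -, rfl⟩ := Finset.mem_image.mp hp
    rw [Finset.mem_insert, Finset.mem_singleton] at hx
    rcases hx with rfl | rfl
    · rfl
    · rw [(hσ y).2, Finset.pair_comm]
  have hmem : ∀ x, ({x, σ x} : Finset (Label N)) ∈ parts := fun x =>
    Finset.mem_image_of_mem (fun x => ({x, σ x} : Finset (Label N))) (Finset.mem_univ x)
  let P : Finpartition (Finset.univ : Finset (Label N)) :=
    Finpartition.ofExistsUnique parts (fun p _ => Finset.subset_univ p)
      (fun x _ => ⟨{x, σ x}, ⟨hmem x, by simp⟩, fun p hp => hP p hp.1 x hp.2⟩)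
      (fun h => by
        obtain ⟨y, -, hy⟩ := Finset.mem_image.mp h
        simp at hy)
  have hc : ∀ p ∈ P.parts, p.card = 2 := by
    intro p hp
    obtain ⟨y, -, rfl⟩ := Finset.mem_image.mp (show p ∈ parts from hp)
    exact Finset.card_pair (hσ y).1.symm
  refine ⟨⟨P, hc⟩, Equiv.ext fun x => ?_⟩
  rw [← pair_mem_parts_iff]
  exact hmem x

theorem sum_gluing_eq_sum_matchings (τ : Equiv.Perm (Label N)) (F : Equiv.Perm (Label N) → ℝ) :
    ∑ ω : Gluing N, F (matchingOf ω) = ∑ σ ∈ matchings ∅ τ, F σ := by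
  refine Finset.sum_bij (fun ω _ => matchingOf ω) (fun ω _ => ?_)
    (fun ω _ ω' _ h => matchingOf_injective h) (fun σ hσ => ?_) (fun _ _ => rfl)
  · exact mem_matchings.mpr ⟨isMatching_matchingOf ω, by simp⟩
  · obtain ⟨ω, hω⟩ := exists_matchingOf_eq (mem_matchings.mp hσ).1
    exact ⟨ω, Finset.mem_univ _, hω⟩

theorem occursIn_toList_iff {k : ℕ} [NeZero k] (ω : Gluing N) (s : ZMod k → Passage N) :
    OccursIn ω (toList s) ↔ Occurs (matchingOf ω) s := by
  rw [OccursIn, cycle_chain_toList_iff]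
  exact forall_congr' fun i => pair_mem_parts_iff ω _ _

end Gluings

/-! ### Counting curves by cyclic sequences -/

section Counting

variable {N k : ℕ}

instance : Fintype Turn := ⟨{Turn.L, Turn.R}, fun t => by cases t <;> simp⟩

/-- The class of a cyclic sequence of passages. -/
def curveClass (s : ZMod k → Passage N) : CurveClass N := Quotient.mk _ (toList s)

/-- The class of a cyclic word. -/
def wordClass (v : ZMod k → Turn) : WordClass := WordClass.mk (toList v)

theorem Passage.turn_flip (p : Passage N) : p.flip.turn = p.turn.swap := by
  have h1 := p.2.1
  have h2 := p.2.2
  have h3 : p.1.1.val ≠ p.1.2.val := fun h => h1 (Fin.ext h)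
  unfold Passage.turn Passage.flip
  by_cases h : p.1.2.val % 3 = (p.1.1.val + 1) % 3
  · rw [if_pos h, if_neg (by dsimp only; omega)]; rfl
  · rw [if_neg h, if_pos (by dsimp only; omega)]; rfl

/-- The class of the word of turns of a curve. -/
def turnClass (s : ZMod k → Passage N) : WordClass := wordClass fun i => (s i).turn

theorem toList_map_turn (s : ZMod k → Passage N) :
    WordClass.mk ((toList s).map Passage.turn) = turnClass s := by
  unfold turnClass wordClass toList
  rw [List.map_ofFn]
  rfl

variable [NeZero k]

theorem curveClass_eq_iff (s s' : ZMod k → Passage N) : curveClass s = curveClass s' ↔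
    (∃ j, ∀ i, s' i = s (i + j)) ∨ ∃ j, ∀ i, s' i = (s (j - i)).flip :=
  Quotient.eq.trans (cyclicRevSetoid_toList_iff _ _ s s')

theorem wordClass_eq_iff (v v' : ZMod k → Turn) : wordClass v = wordClass v' ↔
    (∃ j, ∀ i, v' i = v (i + j)) ∨ ∃ j, ∀ i, v' i = (v (j - i)).swap :=
  Quotient.eq.trans (cyclicRevSetoid_toList_iff _ _ v v')

theorem turnClass_eq_of_curveClass_eq {s s' : ZMod k → Passage N}
    (h : curveClass s = curveClass s') : turnClass s = turnClass s' := by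
  refine (wordClass_eq_iff _ _).mpr ?_
  rcases (curveClass_eq_iff s s').mp h with ⟨j, hj⟩ | ⟨j, hj⟩
  · exact Or.inl ⟨j, fun i => by rw [hj]⟩
  · exact Or.inr ⟨j, fun i => by rw [hj, Passage.turn_flip]⟩

theorem CyclicPrimitive.of_curveClass_eq {s s' : ZMod k → Passage N}
    (h : curveClass s = curveClass s') (hs : CyclicPrimitive s) : CyclicPrimitive s' := by
  intro m hm he
  rcases (curveClass_eq_iff s s').mp h with ⟨j, hj⟩ | ⟨j, hj⟩
  · refine hs m hm (funext fun i => ?_)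
    have := congrFun he (i - j)
    simp only [hj] at this
    rwa [sub_add_cancel, show i - j + m + j = i + m by ring] at this
  · refine hs m hm (funext fun i => ?_)
    have := congrFun he (j - i - m)
    simp only [hj] at this
    have h2 := Passage.flip_involutive.injective this
    rw [show j - (j - i - m + m) = i by ring, show j - (j - i - m) = i + m by ring] at h2
    exact h2.symm

theorem Occurs.of_curveClass_eq {σ : Equiv.Perm (Label N)} (hσ : IsMatching σ)
    {s s' : ZMod k → Passage N} (h : curveClass s = curveClass s') (hs : Occurs σ s) :
    Occurs σ s' := by
  intro i
  rcases (curveClass_eq_iff s s').mp h with ⟨j, hj⟩ | ⟨j, hj⟩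
  · rw [hj, hj, hs, add_right_comm]
  · rw [hj, hj]
    have := hs.apply_entry hσ (j - i)
    simp only [Passage.flip]
    rw [this]
    congr 3
    ring

open Classical in
/-- The primitive cyclic sequences of `k` passages whose word of turns has class `c`. -/
def curvesWithType (N k : ℕ) [NeZero k] (c : WordClass) : Finset (ZMod k → Passage N) :=
  Finset.univ.filter fun s => CyclicPrimitive s ∧ turnClass s = c

theorem mem_curvesWithType {c : WordClass} {s : ZMod k → Passage N} :
    s ∈ curvesWithType N k c ↔ CyclicPrimitive s ∧ turnClass s = c := by
  simp [curvesWithType]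

theorem mem_curvesOfType_iff (ω : Gluing N) {c : WordClass} (hc : c.length = k)
    (γ : CurveClass N) : γ ∈ curvesOfType ω c ↔
      ∃ s ∈ curvesWithType N k c, Occurs (matchingOf ω) s ∧ curveClass s = γ := by
  constructor
  · rintro ⟨α, hγ, hocc, hprim, htype⟩
    have hlen : α.length = k := by
      rw [← hc, ← htype]
      change α.length = (α.map Passage.turn).length
      simp
    obtain ⟨s, rfl⟩ := exists_toList_eq α hlen
    exact ⟨s, mem_curvesWithType.mpr ⟨(toList_primitive_iff s).mp hprim,
      by rw [← htype, toList_map_turn]⟩, (occursIn_toList_iff ω s).mp hocc, hγ⟩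
  · rintro ⟨s, hs, hocc, rfl⟩
    obtain ⟨hprim, htype⟩ := mem_curvesWithType.mp hs
    exact ⟨toList s, rfl, (occursIn_toList_iff ω s).mpr hocc, (toList_primitive_iff s).mpr hprim,
      by rw [toList_map_turn, htype]⟩

/-- The sequences in a given class. -/
def shiftOrFlip (s : ZMod k → Passage N) : ZMod k ⊕ ZMod k → (ZMod k → Passage N)
  | Sum.inl j => fun i => s (i + j)
  | Sum.inr j => fun i => (s (j - i)).flip

/-- Primitivity separates the k rotations from each other, and likewise the k reversed ones; a
coincidence between the two kinds would make the curve its own reversal. -/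
theorem shiftOrFlip_injective {σ : Equiv.Perm (Label N)} (hσ : IsMatching σ)
    {s : ZMod k → Passage N} (hs : CyclicPrimitive s) (h : Occurs σ s) :
    Function.Injective (shiftOrFlip s) := by
  have hmix : ∀ j j' : ZMod k, shiftOrFlip s (Sum.inl j) ≠ shiftOrFlip s (Sum.inr j') := by
    intro j j' he
    refine not_occurs_of_eq_flip hσ h (j' + j) fun i => ?_
    have := congrFun he (i - j)
    simp only [shiftOrFlip, sub_add_cancel] at this
    rw [this]
    congr 2
    ring
  have hinj : ∀ j j' : ZMod k, (∀ i, s (i + j) = s (i + j')) → j = j' := by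
    intro j j' h'
    by_contra hne
    refine hs (j - j') (sub_ne_zero.mpr hne) (funext fun i => ?_)
    have := h' (i - j')
    rw [sub_add_cancel] at this
    rw [← this]
    congr 1
    ring
  rintro (j | j) (j' | j') he
  · rw [hinj j j' fun i => congrFun he i]
  · exact absurd he (hmix _ _)
  · exact absurd he.symm (hmix _ _)
  · rw [hinj j j' fun i => ?_]
    have := congrFun he (-i)
    simp only [shiftOrFlip, sub_neg_eq_add] at this
    rw [add_comm i, add_comm i]
    exact Passage.flip_involutive.injective this

open Classical in
/-- Every class of primitive curves is represented by exactly `2k` cyclic sequences. -/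
theorem two_mul_curveCount (ω : Gluing N) {c : WordClass} (hc : c.length = k) :
    2 * k * curveCount N c ω =
      ((curvesWithType N k c).filter fun s => Occurs (matchingOf ω) s).card := by
  set S := (curvesWithType N k c).filter fun s => Occurs (matchingOf ω) s with hS
  have hσ := isMatching_matchingOf ω
  have himg : curvesOfType ω c = (S.image curveClass : Finset (CurveClass N)) := by
    ext γ
    rw [mem_curvesOfType_iff ω hc]
    simp [hS, and_assoc]
  rw [curveCount, himg, Set.ncard_coe_finset]
  have hfib : ∀ γ ∈ S.image curveClass, (S.filter fun s => curveClass s = γ).card = 2 * k := by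
    intro γ hγ
    obtain ⟨s, hs, rfl⟩ := Finset.mem_image.mp hγ
    obtain ⟨hs1, hs2⟩ := Finset.mem_filter.mp hs
    obtain ⟨hs3, hs4⟩ := mem_curvesWithType.mp hs1
    have : (S.filter fun s' => curveClass s' = curveClass s)
        = Finset.univ.image (shiftOrFlip s) := by
      ext s'
      rw [Finset.mem_filter, Finset.mem_image]
      constructor
      · rintro ⟨-, h⟩
        rcases (curveClass_eq_iff s s').mp h.symm with ⟨j, hj⟩ | ⟨j, hj⟩
        · exact ⟨Sum.inl j, Finset.mem_univ _, (funext hj).symm⟩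
        · exact ⟨Sum.inr j, Finset.mem_univ _, (funext hj).symm⟩
      · rintro ⟨x, -, rfl⟩
        have hcl : curveClass s = curveClass (shiftOrFlip s x) := by
          rw [curveClass_eq_iff]
          rcases x with j | j
          · exact Or.inl ⟨j, fun i => rfl⟩
          · exact Or.inr ⟨j, fun i => rfl⟩
        refine ⟨Finset.mem_filter.mpr ⟨mem_curvesWithType.mpr ⟨hs3.of_curveClass_eq hcl, ?_⟩,
          hs2.of_curveClass_eq hσ hcl⟩, hcl.symm⟩
        rw [← turnClass_eq_of_curveClass_eq hcl, hs4]
    rw [this, Finset.card_image_of_injective _ (shiftOrFlip_injective hσ hs3 hs2),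
      Finset.card_univ, Fintype.card_sum, ZMod.card, two_mul]
  rw [Finset.card_eq_sum_card_fiberwise (f := curveClass) (t := S.image curveClass)
    fun s hs => Finset.mem_coe.mpr (Finset.mem_image_of_mem _ hs), Finset.sum_congr rfl hfib,
    Finset.sum_const, smul_eq_mul, mul_comm]

theorem size_eq_card {c : WordClass} (hc : c.length = k) :
    c.size = (open Classical in Finset.univ.filter fun v : ZMod k → Turn => wordClass v = c).card := by
  classical
  rw [WordClass.size]
  have : {w : List Turn | WordClass.mk w = c} =
      ((Finset.univ.filter fun v : ZMod k → Turn => wordClass v = c).image toList :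
        Finset (List Turn)) := by
    ext w
    simp only [Set.mem_ofPred_eq, Finset.coe_image, Finset.coe_filter, Finset.mem_univ, true_and,
      Set.mem_image]
    constructor
    · intro h
      obtain ⟨v, rfl⟩ := exists_toList_eq (k := k) w (by rw [← hc, ← h]; rfl)
      exact ⟨v, h, rfl⟩
    · rintro ⟨v, h, rfl⟩; exact h
  rw [this, Set.ncard_coe_finset, Finset.card_image_of_injective _ toList_injective]

/-- A class consists of the rotations of one word and of its swapped reversal. Consequently λ_c ≤ 1,
as the bound on the Stein solution requires. -/
theorem size_le {c : WordClass} (hc : c.length = k) : c.size ≤ 2 * k := by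
  classical
  rw [size_eq_card hc]
  rcases Finset.eq_empty_or_nonempty
    (Finset.univ.filter fun v : ZMod k → Turn => wordClass v = c) with h | ⟨v, hv⟩
  · rw [h]; simp
  have hsub : (Finset.univ.filter fun v : ZMod k → Turn => wordClass v = c) ⊆
      (Finset.univ.image fun j : ZMod k => fun i => v (i + j)) ∪
        Finset.univ.image fun j : ZMod k => fun i => (v (j - i)).swap := by
    intro v' hv'
    have h : wordClass v = wordClass v' := by
      rw [(Finset.mem_filter.mp hv).2, (Finset.mem_filter.mp hv').2]
    rw [Finset.mem_union, Finset.mem_image, Finset.mem_image]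
    rcases (wordClass_eq_iff v v').mp h with ⟨j, hj⟩ | ⟨j, hj⟩
    · exact Or.inl ⟨j, Finset.mem_univ _, (funext hj).symm⟩
    · exact Or.inr ⟨j, Finset.mem_univ _, (funext hj).symm⟩
  refine (Finset.card_le_card hsub).trans ((Finset.card_union_le _ _).trans ?_)
  have h1 := Finset.card_image_le (s := Finset.univ) (f := fun j : ZMod k => fun i => v (i + j))
  have h2 := Finset.card_image_le (s := Finset.univ)
    (f := fun j : ZMod k => fun i => (v (j - i)).swap)
  rw [Finset.card_univ, ZMod.card] at h1 h2
  omega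

end Counting

/-! ### First moment estimates -/

section Estimates

variable {N : ℕ}

theorem exists_isMatching (N : ℕ) : ∃ σ : Equiv.Perm (Label N), IsMatching σ := by
  have e : Label N ≃ Fin (3 * N) × Bool := Fintype.equivOfCardEq (by simp; ring)
  have h : Function.Involutive fun x : Label N => e.symm ((e x).1, !(e x).2) := fun x => by simp
  refine ⟨h.toPerm _, fun x => ⟨fun hx => ?_, h x⟩⟩
  have := congrArg (fun y => (e y).2) hx
  simp at this

/-- A passage is given by its triangle, the position of the side of entry, and the turn. -/
def passageCode (p : Passage N) : Fin (2 * N) × Fin 3 × Turn :=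
  (triangle p.1.1, ⟨p.1.1.val % 3, Nat.mod_lt _ (by norm_num)⟩, p.turn)

theorem passageCode_bijective : Function.Bijective (passageCode (N := N)) := by
  constructor
  · intro p q h
    simp only [passageCode, Prod.mk.injEq, triangle, Fin.mk.injEq] at h
    obtain ⟨h1, h2, h3⟩ := h
    have hp := p.2.2
    have hq := q.2.2
    have hp' : p.1.1.val ≠ p.1.2.val := fun h => p.2.1 (Fin.ext h)
    have hq' : q.1.1.val ≠ q.1.2.val := fun h => q.2.1 (Fin.ext h)
    refine Passage.ext_sides (Fin.ext (by omega)) (Fin.ext ?_)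
    unfold Passage.turn at h3
    split_ifs at h3 <;> omega
  · rintro ⟨t, r, v⟩
    have ht := t.2
    have hr := r.2
    rcases v with _ | _
    · refine ⟨⟨(⟨3 * t + r, by omega⟩, ⟨3 * t + (r + 2) % 3, by omega⟩), ?_, ?_⟩, ?_⟩
      · intro h; rw [Fin.mk.injEq] at h; omega
      · dsimp only; omega
      · simp only [passageCode, triangle, Passage.turn, Prod.mk.injEq]
        refine ⟨Fin.ext (by dsimp only; omega), Fin.ext (by dsimp only; omega), ?_⟩
        rw [if_neg (by omega)]
    · refine ⟨⟨(⟨3 * t + r, by omega⟩, ⟨3 * t + (r + 1) % 3, by omega⟩), ?_, ?_⟩, ?_⟩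
      · intro h; rw [Fin.mk.injEq] at h; omega
      · dsimp only; omega
      · simp only [passageCode, triangle, Passage.turn, Prod.mk.injEq]
        refine ⟨Fin.ext (by dsimp only; omega), Fin.ext (by dsimp only; omega), ?_⟩
        rw [if_pos (by omega)]

theorem card_turn : Fintype.card Turn = 2 := rfl

theorem card_passages_le (T : Finset (Fin (2 * N))) :
    (Finset.univ.filter fun p : Passage N => triangle p.1.1 ∈ T).card ≤ 6 * T.card := by
  have h := Finset.card_le_card_of_injOn (s := Finset.univ.filter
    fun p : Passage N => triangle p.1.1 ∈ T) (t := T ×ˢ (Finset.univ : Finset (Fin 3 × Turn)))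
    passageCode (fun p hp => by
      have := (Finset.mem_filter.mp hp).2
      simpa [passageCode] using this) passageCode_bijective.1.injOn
  rw [Finset.card_product, Finset.card_univ, Fintype.card_prod, card_turn, Fintype.card_fin] at h
  omega

variable {k : ℕ}

/-- The indicator of the event that a curve occurs. -/
def occursInd (s : ZMod k → Passage N) (σ : Equiv.Perm (Label N)) : ℝ :=
  open Classical in if Occurs σ s then 1 else 0

theorem occursInd_nonneg (s : ZMod k → Passage N) (σ : Equiv.Perm (Label N)) :
    0 ≤ occursInd s σ := by
  unfold occursInd; split_ifs <;> norm_num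

variable [NeZero k]

-- Choose the t new triangles in at most (2N)^t ways. Each passage then lies in one of at most 2m +
-- 1 triangles, with 6 passages per triangle.
open Classical in
theorem card_filter_triangles_le (m : ℕ) (hk : k ≤ m) (T₀ : Finset (Fin (2 * N)))
    (hT₀ : T₀.card ≤ m + 1) (t : ℕ) (ht : t ≤ m) :
    (Finset.univ.filter fun s : ZMod k → Passage N => (triangles s \ T₀).card = t).card ≤
      (2 * N) ^ t * (12 * m + 6) ^ m := by
  have hsub : (Finset.univ.filter fun s : ZMod k → Passage N => (triangles s \ T₀).card = t) ⊆
      (Finset.powersetCard t Finset.univ).biUnion fun T' => Fintype.piFinset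
        fun _ : ZMod k => Finset.univ.filter fun p : Passage N => triangle p.1.1 ∈ T₀ ∪ T' := by
    intro s hs
    rw [Finset.mem_biUnion]
    refine ⟨triangles s \ T₀, Finset.mem_powersetCard.mpr ⟨Finset.subset_univ _,
      (Finset.mem_filter.mp hs).2⟩, Fintype.mem_piFinset.mpr fun i => ?_⟩
    rw [Finset.mem_filter, Finset.union_sdiff_self_eq_union]
    exact ⟨Finset.mem_univ _, Finset.mem_union_right _ (triangle_mem_triangles
      (entry_mem_labels s i))⟩
  refine (Finset.card_le_card hsub).trans ((Finset.card_biUnion_le_card_mul _ _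
    ((12 * m + 6) ^ m) fun T' hT' => ?_).trans ?_)
  · rw [Fintype.card_piFinset, Finset.prod_const, Finset.card_univ, ZMod.card]
    refine (Nat.pow_le_pow_left ((card_passages_le _).trans ?_) k).trans
      (Nat.pow_le_pow_right (by omega) hk)
    have := Finset.card_union_le T₀ T'
    rw [(Finset.mem_powersetCard.mp hT').2] at this
    omega
  · rw [Finset.card_powersetCard, Finset.card_univ, Fintype.card_fin]
    exact Nat.mul_le_mul_right _ (Nat.choose_le_pow _ _)

variable {τ : Equiv.Perm (Label N)}

/-- The event that s occurs amounts to agreement with τ on the sides of s, so conditioning on it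
enlarges the prescribed set A. -/
theorem avg_occursInd_mul (hτ : IsMatching τ) {s : ZMod k → Passage N} (hs : Occurs τ s)
    (A : Finset (Label N)) (F : Equiv.Perm (Label N) → ℝ) :
    avg A τ (fun σ => occursInd s σ * F σ) =
      (matchings (A ∪ labels s) τ).card / (matchings A τ).card * avg (A ∪ labels s) τ F := by
  classical
  have h1 : matchings (A ∪ labels s) τ = (matchings A τ).filter fun σ => Occurs σ s := by
    ext σ
    rw [Finset.mem_filter, mem_matchings, mem_matchings]
    constructor
    · rintro ⟨h1, h2⟩
      exact ⟨⟨h1, fun x hx => h2 x (Finset.mem_union_left _ hx)⟩,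
        (hs.iff_eqOn h1 hτ).mpr fun x hx => h2 x (Finset.mem_union_right _ hx)⟩
    · rintro ⟨⟨h1, h2⟩, h3⟩
      refine ⟨h1, fun x hx => ?_⟩
      rcases Finset.mem_union.mp hx with hx | hx
      · exact h2 x hx
      · exact (hs.iff_eqOn h1 hτ).mp h3 x hx
  have h2 : ∑ σ ∈ matchings A τ, occursInd s σ * F σ = ∑ σ ∈ matchings (A ∪ labels s) τ, F σ := by
    rw [h1, Finset.sum_filter]
    refine Finset.sum_congr rfl fun σ _ => ?_
    unfold occursInd
    split_ifs <;> simp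
  have h3 := card_matchings_pos hτ (A ∪ labels s)
  have h4 := card_matchings_pos hτ A
  rw [avg, avg, h2]
  field_simp

/-- At most 4N of the 6N labels get used, so each newly prescribed pair has conditional probability
at most 1/(2N), and at least t + 1 pairs are new. -/
theorem avg_occursInd_le (hN : 1 ≤ N) {A : Finset (Label N)}
    (hA : ClosedUnder τ A) (s : ZMod k → Passage N) (hcard : A.card + 2 * k ≤ 4 * N) (t : ℕ)
    (h : ∀ σ ∈ matchings A τ, Occurs σ s → A.card + 2 * (t + 1) ≤ (A ∪ labels s).card) :
    avg A τ (occursInd s) ≤ 1 / (2 * N : ℝ) ^ (t + 1) := by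
  have hN' : (1 : ℝ) ≤ N := by exact_mod_cast hN
  by_cases hex : ∃ σ ∈ matchings A τ, Occurs σ s
  · obtain ⟨σ, hσA, hσs⟩ := hex
    obtain ⟨hσ, hστ⟩ := mem_matchings.mp hσA
    have hAσ : ClosedUnder σ A := fun x hx => by rw [hστ x hx]; exact hA x hx
    have hBcard : (A ∪ labels s).card ≤ 4 * N :=
      ((Finset.card_union_le _ _).trans (Nat.add_le_add_left (card_labels_le s) _)).trans hcard
    have hBcard' : ((A ∪ labels s).card : ℝ) ≤ 4 * N := by exact_mod_cast hBcard
    obtain ⟨e, he, hle⟩ := pow_mul_card_matchings_le hσ hAσ (hAσ.union (hσs.closedUnder hσ))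
      Finset.subset_union_left (2 * N) (by positivity) (by
        rw [Fintype.card_fin]; push_cast; linarith)
    have hte : t + 1 ≤ e := by have := h σ hσA hσs; omega
    have h1 := avg_occursInd_mul hσ hσs A (fun _ => 1)
    simp only [mul_one, avg_const hσ] at h1
    have h2 : avg A τ (occursInd s) = avg A σ (occursInd s) := by
      unfold avg; rw [matchings_congr hσA]
    rw [h2]
    refine h1.le.trans ?_
    have hpos := card_matchings_pos hσ A
    rw [div_le_div_iff₀ hpos (by positivity), one_mul, mul_comm]
    refine le_trans ?_ hle
    gcongr
    linarith
  · have : avg A τ (occursInd s) = 0 := by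
      unfold avg
      rw [Finset.sum_eq_zero, zero_div]
      intro σ hσ
      unfold occursInd
      rw [if_neg fun h' => hex ⟨σ, hσ, h'⟩]
    rw [this]
    positivity

/-- For each t ≤ m, about N^t curves with t new triangles face a probability of at most (2N)^(-t-1).
One factor 1/(2N) survives for every t. -/
theorem sum_avg_occursInd_le (hN : 1 ≤ N) {m : ℕ} (hk : k ≤ m) (hm : m ≤ N)
    {A : Finset (Label N)} (hA : ClosedUnder τ A) (hAm : A.card ≤ 2 * m)
    (T₀ : Finset (Fin (2 * N))) (hT₀ : T₀.card ≤ m + 1) (C : Finset (ZMod k → Passage N))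
    (hC : ∀ s ∈ C, ∀ σ ∈ matchings A τ, Occurs σ s →
      A.card + 2 * ((triangles s \ T₀).card + 1) ≤ (A ∪ labels s).card) :
    ∑ s ∈ C, avg A τ (occursInd s) ≤ (m + 1) * (12 * m + 6) ^ m / (2 * N) := by
  classical
  have hN' : (1 : ℝ) ≤ N := by exact_mod_cast hN
  calc ∑ s ∈ C, avg A τ (occursInd s)
      ≤ ∑ s ∈ C, 1 / (2 * N : ℝ) ^ ((triangles s \ T₀).card + 1) :=
        Finset.sum_le_sum fun s hs => avg_occursInd_le hN hA s (by omega) _ (hC s hs)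
    _ ≤ ∑ s : ZMod k → Passage N, 1 / (2 * N : ℝ) ^ ((triangles s \ T₀).card + 1) :=
        Finset.sum_le_sum_of_subset_of_nonneg (Finset.subset_univ C) fun _ _ _ => by positivity
    _ = ∑ t ∈ Finset.range (m + 1), ∑ s ∈ Finset.univ.filter
          fun s : ZMod k → Passage N => (triangles s \ T₀).card = t,
            1 / (2 * N : ℝ) ^ ((triangles s \ T₀).card + 1) := by
        refine (Finset.sum_fiberwise_of_maps_to (fun s _ => ?_) _).symm
        have h1 := Finset.card_le_card (Finset.sdiff_subset (s := triangles s) (t := T₀))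
        have h2 := card_triangles_le s
        rw [Finset.mem_range]
        omega
    _ ≤ ∑ t ∈ Finset.range (m + 1), (12 * m + 6 : ℝ) ^ m / (2 * N) := by
        refine Finset.sum_le_sum fun t ht => ?_
        have ht' : t ≤ m := by rw [Finset.mem_range] at ht; omega
        have hcard : (((Finset.univ.filter
            fun s : ZMod k → Passage N => (triangles s \ T₀).card = t).card : ℕ) : ℝ) ≤
            (2 * N) ^ t * (12 * m + 6) ^ m := by
          exact_mod_cast card_filter_triangles_le m hk T₀ hT₀ t ht'
        rw [Finset.sum_congr rfl fun s hs => by rw [(Finset.mem_filter.mp hs).2], Finset.sum_const,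
          nsmul_eq_mul, mul_one_div, div_le_div_iff₀ (by positivity) (by positivity)]
        calc _ ≤ ((2 * N : ℝ) ^ t * (12 * m + 6) ^ m) * (2 * N) := by gcongr
          _ = _ := by ring
    _ = _ := by
        rw [Finset.sum_const, Finset.card_range, nsmul_eq_mul]
        push_cast
        ring

/-! ### Simple curves -/

theorem Simple.exists_occurs {s : ZMod k → Passage N} (hs : Simple s) :
    ∃ σ : Equiv.Perm (Label N), IsMatching σ ∧ Occurs σ s := by
  obtain ⟨τ, hτ⟩ := exists_isMatching N
  have h1 : Function.Injective fun i => (s i).1.2 := by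
    intro i j h
    change (s i).1.2 = (s j).1.2 at h
    exact hs (by simp only [Passage.triangle_eq, h])
  have h2 : Function.Injective fun i => (s (i + 1)).1.1 := by
    intro i j h
    change (s (i + 1)).1.1 = (s (j + 1)).1.1 at h
    exact add_right_cancel (hs (a₁ := i + 1) (a₂ := j + 1) (by simp only [h]))
  have h3 : ∀ i j, (s i).1.2 ≠ (s (j + 1)).1.1 := by
    intro i j h
    have : i = j + 1 := hs (by simp only [Passage.triangle_eq (s i), h])
    subst this
    exact (s (j + 1)).2.1 h.symm
  obtain ⟨σ, hσ, h⟩ := exists_matching_extending hτ _ _ h1 h2 h3 Finset.univ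
  exact ⟨σ, hσ, fun i => h i (Finset.mem_univ i)⟩

theorem Simple.card_labels {s : ZMod k → Passage N} (hs : Simple s) :
    (labels s).card = 2 * k := by
  rw [labels, Finset.card_union_of_disjoint, Finset.card_image_of_injective,
    Finset.card_image_of_injective, Finset.card_univ, ZMod.card, two_mul]
  · intro i j h
    refine hs ?_
    change (s i).1.2 = (s j).1.2 at h
    simp only [Passage.triangle_eq, h]
  · intro i j h
    refine hs ?_
    change (s i).1.1 = (s j).1.1 at h
    simp only [h]
  · rw [Finset.disjoint_left]
    intro x h1 h2
    obtain ⟨i, -, hi⟩ := Finset.mem_image.mp h1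
    obtain ⟨j, -, hj⟩ := Finset.mem_image.mp h2
    have : i = j := hs (by simp only [Passage.triangle_eq (s j), hj, hi])
    subst this
    exact (s i).2.1 (hi.trans hj.symm)

/-- The product of the numbers of choices of the partners of `k` labels. -/
def pairingWeight (N k : ℕ) : ℝ := ∏ i ∈ Finset.range k, ((6 * N : ℝ) - 2 * i - 1)

theorem Simple.avg_occursInd_mul {s : ZMod k → Passage N} (hs : Simple s) (hτ : IsMatching τ)
    (h : Occurs τ s) (F : Equiv.Perm (Label N) → ℝ) :
    avg ∅ τ (fun σ => occursInd s σ * F σ) = 1 / pairingWeight N k * avg (labels s) τ F := by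
  rw [RandomSurface.avg_occursInd_mul hτ h, Finset.empty_union]
  congr 1
  obtain ⟨e, he, hc⟩ := card_matchings_empty hτ (h.closedUnder hτ)
  have hek : e = k := by rw [hs.card_labels] at he; omega
  subst hek
  rw [hc, Fintype.card_fin]
  have h1 := card_matchings_pos hτ (labels s)
  have h2 := card_matchings_pos hτ (∅ : Finset (Label N))
  rw [hc, Fintype.card_fin] at h2
  have h3 : pairingWeight N e = ∏ i ∈ Finset.range e, (((6 * N : ℕ) : ℝ) - 2 * i - 1) := by
    unfold pairingWeight; push_cast; rfl
  rw [← h3] at h2 ⊢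
  have h4 : pairingWeight N e ≠ 0 := left_ne_zero_of_mul h2.ne'
  field_simp

-- A sequence amounts to a sequence of triangles, of entry positions, and of turns. Simplicity
-- concerns only the triangles, the type only the turns, and simplicity already implies primitivity.
open Classical in
theorem card_simple_curvesWithType {c : WordClass} (hc : c.length = k) :
    ((curvesWithType N k c).filter Simple).card = (2 * N).descFactorial k * 3 ^ k * c.size := by
  let e : (ZMod k → Passage N) ≃ (ZMod k → Fin (2 * N)) × (ZMod k → Fin 3) × (ZMod k → Turn) :=
    ((Equiv.refl (ZMod k)).arrowCongr (Equiv.ofBijective _ passageCode_bijective)).trans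
      ((Equiv.arrowProdEquivProdArrow _ _ _).trans
        ((Equiv.refl _).prodCongr (Equiv.arrowProdEquivProdArrow _ _ _)))
  have he : ∀ s, e s = (fun i => triangle (s i).1.1, fun i => (passageCode (s i)).2.1,
      fun i => (s i).turn) := fun s => rfl
  rw [Finset.card_equiv e (t := (Finset.univ.filter fun f : ZMod k → Fin (2 * N) =>
    Function.Injective f) ×ˢ (Finset.univ : Finset (ZMod k → Fin 3)) ×ˢ
      (Finset.univ.filter fun v : ZMod k → Turn => wordClass v = c))]
  · rw [Finset.card_product, Finset.card_product, ← size_eq_card hc, Finset.card_univ,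
      Fintype.card_fun, ZMod.card, Fintype.card_fin, mul_assoc]
    congr 1
    rw [← Fintype.card_subtype, Fintype.card_congr (Equiv.subtypeInjectiveEquivEmbedding _ _),
      Fintype.card_embedding_eq, ZMod.card, Fintype.card_fin]
  · intro s
    rw [he, Finset.mem_filter, mem_curvesWithType, Finset.mem_product, Finset.mem_product,
      Finset.mem_filter, Finset.mem_filter]
    simp only [Finset.mem_univ, true_and]
    constructor
    · rintro ⟨⟨-, h1⟩, h2⟩; exact ⟨h2, h1⟩
    · rintro ⟨h2, h1⟩; exact ⟨⟨Simple.cyclicPrimitive h2, h1⟩, h2⟩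

/-- The expected number of simple closed curves following a fixed word from some label. -/
theorem abs_expected_simple_sub_one_le (hN : 1 ≤ N) {k m : ℕ} (hk1 : 1 ≤ k) (hk : k ≤ m)
    (hm : m ≤ N) :
    |((2 * N).descFactorial k * 3 ^ k : ℕ) / pairingWeight N k - 1| ≤ (m : ℝ) ^ 2 / (2 * N) ∧
      ((2 * N).descFactorial k * 3 ^ k : ℕ) / pairingWeight N k ≤ 2 := by
  have hN' : (1 : ℝ) ≤ N := by exact_mod_cast hN
  have hm' : (m : ℝ) ≤ N := by exact_mod_cast hm
  have hm1 : (1 : ℝ) ≤ m := by exact_mod_cast hk1.trans hk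
  have hk' : (k : ℝ) ≤ m := by exact_mod_cast hk
  -- The ratio is a product of factors 1 - (i-1)/(6N-2i-1) with denominators at least 4N, so each
  -- factor is at least 1 - δ. Only the factor i = 0 exceeds 1, by at most δ.
  set δ : ℝ := m / (4 * N) with hδ
  have hδ0 : 0 ≤ δ := by positivity
  have hδN : δ * (4 * N) = m := by rw [hδ]; field_simp
  have hδ1 : δ ≤ 1 / 4 := by
    rw [hδ, div_le_div_iff₀ (by positivity) (by norm_num)]; linarith
  set a : ℕ → ℝ := fun i => (6 * N - 3 * i : ℝ) / (6 * N - 2 * i - 1) with ha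
  have hrep : ((2 * N).descFactorial k * 3 ^ k : ℕ) / pairingWeight N k =
      ∏ i ∈ Finset.range k, a i := by
    rw [pairingWeight, Finset.prod_div_distrib]
    congr 1
    rw [Nat.descFactorial_eq_prod_range]
    push_cast
    rw [mul_comm, ← Finset.card_range k, ← Finset.prod_const, Finset.card_range,
      ← Finset.prod_mul_distrib]
    refine Finset.prod_congr rfl fun i hi => ?_
    rw [Finset.mem_range] at hi
    rw [Nat.cast_sub (by omega)]
    push_cast
    ring
  have hden : ∀ i : ℕ, i < k → (0 : ℝ) < 6 * N - 2 * i - 1 := by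
    intro i hi
    have : (i : ℝ) + 1 ≤ k := by exact_mod_cast hi
    linarith
  have hlow : ∀ i : ℕ, i < k → 1 - δ ≤ a i := by
    intro i hi
    have hi' : (i : ℝ) + 1 ≤ k := by exact_mod_cast hi
    have hi0 : (0 : ℝ) ≤ i := Nat.cast_nonneg i
    rw [ha, le_div_iff₀ (hden i hi)]
    have : m ≤ δ * (6 * N - 2 * i - 1) := by
      rw [← hδN]
      exact mul_le_mul_of_nonneg_left (by linarith) hδ0
    nlinarith
  have hup : ∀ i : ℕ, 1 ≤ i → i < k → a i ≤ 1 := by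
    intro i hi1 hi
    have hi1' : (1 : ℝ) ≤ i := by exact_mod_cast hi1
    rw [ha, div_le_one (hden i hi)]
    linarith
  have hup0 : a 0 ≤ 1 + δ := by
    have h0 := hden 0 hk1
    rw [ha]
    simp only [Nat.cast_zero, mul_zero, sub_zero] at h0 ⊢
    rw [div_le_iff₀ h0]
    have : 1 ≤ δ * (6 * N - 1) := by
      refine hm1.trans ?_
      rw [← hδN]
      exact mul_le_mul_of_nonneg_left (by linarith) hδ0
    nlinarith
  have key : ∀ j : ℕ, j + 1 ≤ k → 1 - (j + 1) * δ ≤ ∏ i ∈ Finset.range (j + 1), a i ∧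
      ∏ i ∈ Finset.range (j + 1), a i ≤ 1 + δ ∧ 0 ≤ ∏ i ∈ Finset.range (j + 1), a i := by
    intro j
    induction j with
    | zero =>
      intro _
      have := hlow 0 hk1
      simp only [zero_add, Finset.prod_range_one, Nat.cast_zero, one_mul]
      exact ⟨by linarith, hup0, by linarith⟩
    | succ j ih =>
      intro hj
      obtain ⟨h1, h2, h3⟩ := ih (by omega)
      have h4 := hlow (j + 1) hj
      have h5 := hup (j + 1) (by omega) hj
      rw [Finset.prod_range_succ]
      have hj0 : (0 : ℝ) ≤ j := Nat.cast_nonneg j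
      refine ⟨?_, ?_, mul_nonneg h3 (by linarith)⟩
      · have h6 := mul_le_mul_of_nonneg_left h4 h3
        have h7 := mul_le_mul_of_nonneg_right h1 (by linarith : 0 ≤ 1 - δ)
        push_cast
        nlinarith [mul_nonneg hj0 (mul_nonneg hδ0 hδ0), mul_nonneg hδ0 hδ0]
      · exact (mul_le_of_le_one_right h3 h5).trans h2
  obtain ⟨h1, h2, -⟩ := key (k - 1) (by omega)
  rw [Nat.sub_add_cancel hk1, ← hrep] at h1 h2
  have hcast : ((k - 1 : ℕ) : ℝ) + 1 = k := by exact_mod_cast Nat.sub_add_cancel hk1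
  rw [hcast] at h1
  have hmd : (m : ℝ) ^ 2 / (2 * N) = 2 * (m * δ) := by rw [hδ]; field_simp; norm_num
  have h3 : k * δ ≤ m * δ := by gcongr
  have h4 : δ ≤ m * δ := le_mul_of_one_le_left hδ0 hm1
  refine ⟨?_, by linarith⟩
  rw [hmd, abs_le]
  constructor <;> linarith

end Estimates

/-! ### Removing a curve from the counts -/

section Perturbation

variable {N k l : ℕ}

instance : DecidableEq WordClass := Classical.decEq _

instance (N : ℕ) : Nonempty (Gluing N) :=
  let ⟨_, hσ⟩ := exists_isMatching N
  let ⟨ω, _⟩ := exists_matchingOf_eq hσ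
  ⟨ω⟩

/-- The gluing that corresponds to a matching. -/
def gluingOf (σ : Equiv.Perm (Label N)) : Gluing N := Function.invFun matchingOf σ

theorem matchingOf_gluingOf {σ : Equiv.Perm (Label N)} (hσ : IsMatching σ) :
    matchingOf (gluingOf σ) = σ := Function.invFun_eq (exists_matchingOf_eq hσ)

theorem gluingOf_matchingOf (ω : Gluing N) : gluingOf (matchingOf ω) = ω :=
  Function.leftInverse_invFun matchingOf_injective ω

/-- The curve `s` is a shift of `α` or of its reversal. -/
def RunsAlong (α : ZMod k → Passage N) (s : ZMod l → Passage N) : Prop :=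
  l = k ∧ ∃ i : ZMod k, (∀ n : ℕ, s n = α (i + n)) ∨ (∀ n : ℕ, s n = reversed α (i + n))

/-- The numbers of curves in the classes in `W`, where a given curve `γ₀` is not counted. -/
def otherCount (γ₀ : CurveClass N) (W : Finset WordClass) (ω : Gluing N) : W → ℕ :=
  fun c => (curvesOfType ω c.1 \ {γ₀}).ncard

open Classical in
/-- The number of primitive curves of length at most `m` through the label `x`, other than `α`. -/
def throughCount (α : ZMod k → Passage N) (m : ℕ) (x : Label N) (σ : Equiv.Perm (Label N)) : ℝ :=
  ∑ i ∈ Finset.range m, ∑ s ∈ Finset.univ.filter fun s : ZMod (i + 1) → Passage N =>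
    CyclicPrimitive s ∧ x ∈ labels s ∧ ¬ RunsAlong α s, occursInd s σ

theorem throughCount_nonneg (α : ZMod k → Passage N) (m : ℕ) (x : Label N)
    (σ : Equiv.Perm (Label N)) : 0 ≤ throughCount α m x σ :=
  Finset.sum_nonneg fun _ _ => Finset.sum_nonneg fun _ _ => occursInd_nonneg _ _

theorem throughCount_partner (α : ZMod k → Passage N) (m : ℕ) (x : Label N)
    {σ : Equiv.Perm (Label N)} (hσ : IsMatching σ) :
    throughCount α m (σ x) σ = throughCount α m x σ := by
  classical
  unfold throughCount
  refine Finset.sum_congr rfl fun i _ => ?_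
  rw [Finset.sum_filter, Finset.sum_filter]
  refine Finset.sum_congr rfl fun s _ => ?_
  by_cases h : Occurs σ s
  · have : σ x ∈ labels s ↔ x ∈ labels s :=
      ⟨fun hx => by simpa [(hσ x).2] using h.closedUnder hσ _ hx, fun hx => h.closedUnder hσ _ hx⟩
    simp only [this]
  · simp [occursInd, h]

variable [NeZero k]

theorem RunsAlong.curveClass_eq [NeZero l] {α : ZMod k → Passage N} {s : ZMod l → Passage N}
    (h : RunsAlong α s) : curveClass s = curveClass α := by
  obtain ⟨rfl, i, h⟩ := h
  symm
  rw [curveClass_eq_iff]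
  rcases h with h | h
  · refine Or.inl ⟨i, fun j => ?_⟩
    have := h j.val
    rwa [ZMod.natCast_zmod_val, add_comm] at this
  · refine Or.inr ⟨-i, fun j => ?_⟩
    have := h j.val
    rw [ZMod.natCast_zmod_val] at this
    rw [this, reversed]
    congr 2
    ring

/-- The counted curves differ from α, so they need more new pairs than triangles outside those of α
and of x. The extra factor m comes from summing over the lengths. -/
theorem avg_throughCount_le (hN : 1 ≤ N) {m : ℕ} (hk : k ≤ m) (hm : m ≤ N)
    {τ : Equiv.Perm (Label N)} (hτ : IsMatching τ) {α : ZMod k → Passage N} (hα : Simple α)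
    (hατ : Occurs τ α) {A : Finset (Label N)} (hA : ClosedUnder τ A) (hAα : A ⊆ labels α)
    (x : Label N) :
    avg A τ (throughCount α m x) ≤ m * ((m + 1) * (12 * m + 6) ^ m / (2 * N)) := by
  classical
  unfold throughCount
  rw [avg_sum]
  have hAc : A.card ≤ 2 * m :=
    (Finset.card_le_card hAα).trans ((card_labels_le α).trans (by omega))
  refine (Finset.sum_le_card_nsmul _ _ ((m + 1) * (12 * m + 6) ^ m / (2 * N) : ℝ)
    fun i hi => ?_).trans (by rw [Finset.card_range, nsmul_eq_mul])
  rw [avg_sum]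
  refine sum_avg_occursInd_le hN (by rw [Finset.mem_range] at hi; omega) hm hA hAc
    (insert (triangle x) (triangles α)) ?_ _ fun s hs σ hσ h => ?_
  · have h1 := Finset.card_insert_le (triangle x) (triangles α)
    have h2 := card_triangles_le α
    omega
  · obtain ⟨-, hp, hx, hne⟩ := Finset.mem_filter.mp hs
    obtain ⟨hσ1, hσ2⟩ := mem_matchings.mp hσ
    exact Occurs.card_ge_of_mem_labels hσ1 hτ hα hατ hA hAα hσ2 h hp hx hne

theorem curveClass_mem_curvesOfType_iff (ω : Gluing N) {α : ZMod k → Passage N}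
    (hα : CyclicPrimitive α) (c : WordClass) :
    curveClass α ∈ curvesOfType ω c ↔ Occurs (matchingOf ω) α ∧ turnClass α = c := by
  constructor
  · rintro ⟨l, hl, hocc, -, htype⟩
    have hlen : l.length = k := by
      rw [cyclicRevSetoid_length _ _ _ _ (Quotient.exact hl), length_toList]
    obtain ⟨s, rfl⟩ := exists_toList_eq l hlen
    have hcl : curveClass s = curveClass α := hl
    rw [← turnClass_eq_of_curveClass_eq hcl, ← toList_map_turn]
    exact ⟨((occursIn_toList_iff ω s).mp hocc).of_curveClass_eq (isMatching_matchingOf ω) hcl,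
      htype⟩
  · rintro ⟨hocc, htype⟩
    exact ⟨toList α, rfl, (occursIn_toList_iff ω α).mpr hocc, (toList_primitive_iff α).mpr hα,
      by rw [toList_map_turn, htype]⟩

theorem finite_curvesOfType (ω : Gluing N) {c : WordClass} (hc : c.length = k) :
    (curvesOfType ω c).Finite := by
  refine ((curvesWithType N k c).finite_toSet.image curveClass).subset fun γ hγ => ?_
  obtain ⟨s, hs, -, rfl⟩ := (mem_curvesOfType_iff ω hc γ).mp hγ
  exact ⟨s, hs, rfl⟩

theorem curveCountVector_of_occurs {W : Finset WordClass} (c : W) (hc : c.1.length = k)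
    {α : ZMod k → Passage N} (hα : CyclicPrimitive α) (htype : turnClass α = c.1) (ω : Gluing N)
    (hocc : Occurs (matchingOf ω) α) :
    curveCountVector N W ω = otherCount (curveClass α) W ω + Pi.single c 1 := by
  funext d
  rw [Pi.add_apply]
  unfold curveCountVector curveCount otherCount
  by_cases hd : d = c
  · subst hd
    rw [Pi.single_eq_same, Set.ncard_sdiff_singleton_add_one
      ((curveClass_mem_curvesOfType_iff ω hα _).mpr ⟨hocc, htype⟩) (finite_curvesOfType ω hc)]
  · rw [Pi.single_eq_of_ne hd, Set.sdiff_singleton_eq_self, add_zero]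
    intro h
    apply hd
    rw [curveClass_mem_curvesOfType_iff ω hα, htype] at h
    exact Subtype.ext h.2.symm

theorem curveCountVector_of_not_occurs (W : Finset WordClass)
    {α : ZMod k → Passage N} (hα : CyclicPrimitive α) (ω : Gluing N)
    (hocc : ¬ Occurs (matchingOf ω) α) :
    curveCountVector N W ω = otherCount (curveClass α) W ω := by
  funext d
  unfold curveCountVector curveCount otherCount
  rw [Set.sdiff_singleton_eq_self]
  exact fun h => hocc ((curveClass_mem_curvesOfType_iff ω hα _).mp h).1

/-- A curve that is lost must cross a side whose partner has changed, and it is then counted at that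
side. -/
theorem one_le_throughCount {m : ℕ} (α : ZMod k → Passage N) {c : WordClass}
    (hc1 : 1 ≤ c.length) (hcm : c.length ≤ m) {ω ω' : Gluing N} {γ : CurveClass N}
    (hγ : γ ∈ curvesOfType ω c) (hne : γ ≠ curveClass α) (hγ' : γ ∉ curvesOfType ω' c) :
    ∃ x, matchingOf ω x ≠ matchingOf ω' x ∧ 1 ≤ throughCount α m x (matchingOf ω) := by
  classical
  obtain ⟨i, hi⟩ : ∃ i, c.length = i + 1 := ⟨c.length - 1, by omega⟩
  obtain ⟨s, hs, hocc, rfl⟩ := (mem_curvesOfType_iff ω hi γ).mp hγ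
  have hprim := (mem_curvesWithType.mp hs).1
  have hocc' : ¬ Occurs (matchingOf ω') s := fun h =>
    hγ' ((mem_curvesOfType_iff ω' hi _).mpr ⟨s, hs, h, rfl⟩)
  unfold Occurs at hocc'
  push Not at hocc'
  obtain ⟨j, hj⟩ := hocc'
  refine ⟨(s j).1.2, fun h => hj (by rw [← h, hocc]), ?_⟩
  have h1 : occursInd s (matchingOf ω) = 1 := if_pos hocc
  rw [← h1]
  unfold throughCount
  refine le_trans ?_ (Finset.single_le_sum (fun i _ => Finset.sum_nonneg
    fun _ _ => occursInd_nonneg _ _) (Finset.mem_range.mpr (show i < m by omega)))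
  exact Finset.single_le_sum (f := fun s : ZMod (i + 1) → Passage N => occursInd s (matchingOf ω))
    (fun _ _ => occursInd_nonneg _ _)
    (Finset.mem_filter.mpr ⟨Finset.mem_univ _, hprim, exit_mem_labels s j,
      fun h => hne h.curveClass_eq⟩)

theorem exists_of_otherCount_ne {m : ℕ} (α : ZMod k → Passage N) {W : Finset WordClass}
    (hW : ∀ c ∈ W, 1 ≤ c.length ∧ c.length ≤ m) {ω ω' : Gluing N}
    (hne : otherCount (curveClass α) W ω ≠ otherCount (curveClass α) W ω') :
    ∃ x, matchingOf ω x ≠ matchingOf ω' x ∧ (1 ≤ throughCount α m x (matchingOf ω) ∨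
      1 ≤ throughCount α m x (matchingOf ω')) := by
  obtain ⟨c, hc⟩ := Function.ne_iff.mp hne
  obtain ⟨h1, h2⟩ := hW c.1 c.2
  have hset : curvesOfType ω c.1 \ {curveClass α} ≠ curvesOfType ω' c.1 \ {curveClass α} :=
    fun h => hc (by unfold otherCount; rw [h])
  obtain ⟨γ, hγ⟩ : ∃ γ, ¬ (γ ∈ curvesOfType ω c.1 \ {curveClass α} ↔
      γ ∈ curvesOfType ω' c.1 \ {curveClass α}) := by
    by_contra h
    push Not at h
    exact hset (Set.ext h)
  by_cases hγ0 : γ = curveClass α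
  · exact absurd (by simp [hγ0]) hγ
  · have hiff : ¬ (γ ∈ curvesOfType ω c.1 ↔ γ ∈ curvesOfType ω' c.1) := by simpa [hγ0] using hγ
    by_cases h : γ ∈ curvesOfType ω c.1
    · have h' : γ ∉ curvesOfType ω' c.1 := fun h' => hiff (iff_of_true h h')
      obtain ⟨x, hx, hx'⟩ := one_le_throughCount α h1 h2 h hγ0 h'
      exact ⟨x, hx, Or.inl hx'⟩
    · have h' : γ ∈ curvesOfType ω' c.1 := by
        by_contra h'
        exact hiff (iff_of_false h h')
      obtain ⟨x, hx, hx'⟩ := one_le_throughCount α h1 h2 h' hγ0 h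
      exact ⟨x, hx.symm, Or.inr hx'⟩

/-- The effect of prescribing one more pair of a simple curve `α` on a function of the other
curves. -/
theorem abs_avg_sub_avg_addPair_le (hN : 1 ≤ N) {m : ℕ} (hk : k ≤ m) (hm : m ≤ N)
    {τ : Equiv.Perm (Label N)} (hτ : IsMatching τ) {α : ZMod k → Passage N} (hα : Simple α)
    (hατ : Occurs τ α) (f : Equiv.Perm (Label N) → ℝ) (hf : ∀ σ, |f σ| ≤ 3)
    (hdiff : ∀ σ σ', IsMatching σ → IsMatching σ' → f σ ≠ f σ' →
      ∃ x, σ x ≠ σ' x ∧ (1 ≤ throughCount α m x σ ∨ 1 ≤ throughCount α m x σ'))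
    {A : Finset (Label N)} (hA : ClosedUnder τ A) (hAα : A ⊆ labels α) {a : Label N}
    (haα : a ∈ labels α) (ha : a ∉ A) :
    |avg A τ f - avg (addPair τ a A) τ f| ≤
      24 * (m * ((m + 1) * (12 * m + 6) ^ m / (2 * N))) := by
  set κ : ℝ := m * ((m + 1) * (12 * m + 6) ^ m / (2 * N)) with hκ
  set b := τ a with hb
  set A' := addPair τ a A with hA'
  have hA'c : ClosedUnder τ A' := hA.addPair hτ a
  have hA'α : A' ⊆ labels α := addPair_subset (hατ.closedUnder hτ) hAα haα
  have hκA : ∀ x, avg A τ (throughCount α m x) ≤ κ := avg_throughCount_le hN hk hm hτ hα hατ hA hAα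
  have hκA' : ∀ x, avg A' τ (throughCount α m x) ≤ κ :=
    avg_throughCount_le hN hk hm hτ hα hατ hA'c hA'α
  have hnn := fun x σ => throughCount_nonneg α m x σ
  have hn : (0 : ℝ) < ((insert a A)ᶜ).card := by
    have : b ∈ (insert a A)ᶜ := by
      rw [Finset.mem_compl, Finset.mem_insert, not_or]
      exact ⟨(hτ a).1, hA.notMem hτ ha⟩
    exact_mod_cast Finset.card_pos.mpr ⟨b, this⟩
  have hpt : ∀ y ∈ (insert a A)ᶜ, ∀ σ ∈ matchings A' τ, |f (switch y b σ) - f σ| ≤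
      6 * ((throughCount α m y σ + throughCount α m b σ) +
        (throughCount α m a (switch y b σ) + throughCount α m b (switch y b σ))) := by
    intro y hy σ hσ
    rw [Finset.mem_compl, Finset.mem_insert, not_or] at hy
    have hσm := (mem_matchings.mp hσ).1
    have hσm' := hσm.switch y b
    have hsa := (switch_mem_matchings hτ hA hy.1 hy.2 ha hσ).2
    have hsy : switch y b σ y = a := by
      have := (hσm' a).2
      rwa [hsa] at this
    by_cases he : f (switch y b σ) = f σ
    · rw [he, sub_self, abs_zero]
      have := hnn y σ; have := hnn b σ
      have := hnn a (switch y b σ); have := hnn b (switch y b σ)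
      linarith
    · have h6 : |f (switch y b σ) - f σ| ≤ 6 := by
        have h1 := abs_le.mp (hf (switch y b σ))
        have h2 := abs_le.mp (hf σ)
        rw [abs_le]
        constructor <;> linarith
      obtain ⟨x, hx, hx'⟩ := hdiff _ _ hσm' hσm he
      have h0 := hnn y σ
      have h1 := hnn b σ
      have h2 := hnn a (switch y b σ)
      have h3 := hnn b (switch y b σ)
      refine h6.trans ?_
      rcases hx' with hx' | hx'
      · have hmem : x = y ∨ x = b ∨ x = switch y b σ y ∨ x = switch y b σ b := by
          by_contra hno
          push Not at hno
          have := switch_apply_of_ne hσm' hno.1 hno.2.1 hno.2.2.1 hno.2.2.2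
          rw [switch_switch] at this
          exact hx this.symm
        -- After the switch y is the partner of a, so its count can be read off at a. This matters
        -- because the sum over y below averages the switched matchings at a fixed label.
        have hya : throughCount α m y (switch y b σ) = throughCount α m a (switch y b σ) := by
          rw [← hsy, throughCount_partner α m y hσm']
        rcases hmem with rfl | rfl | rfl | rfl
        · linarith
        · linarith
        · rw [throughCount_partner α m _ hσm'] at hx'; linarith
        · rw [throughCount_partner α m _ hσm'] at hx'; linarith
      · have hmem : x = y ∨ x = b ∨ x = σ y ∨ x = σ b := by
          by_contra hno
          push Not at hno
          exact hx (switch_apply_of_ne hσm hno.1 hno.2.1 hno.2.2.1 hno.2.2.2)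
        rcases hmem with rfl | rfl | rfl | rfl
        · linarith
        · linarith
        · rw [throughCount_partner α m _ hσm] at hx'; linarith
        · rw [throughCount_partner α m _ hσm] at hx'; linarith
  have hrep : avg A τ f - avg A' τ f =
      (∑ y ∈ (insert a A)ᶜ, avg A' τ (fun σ => f (switch y b σ) - f σ)) /
        ((insert a A)ᶜ).card := by
    rw [avg_eq_sum_switch hτ hA ha f]
    simp only [avg_sub, Finset.sum_sub_distrib, Finset.sum_const, nsmul_eq_mul]
    field_simp
    rfl
  -- Averaged over y, the switched matchings are distributed as matchings prescribed on A only,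
  -- where the first moment bound applies.
  have hsw : ∀ x, (∑ y ∈ (insert a A)ᶜ, avg A' τ (fun σ => throughCount α m x (switch y b σ))) ≤
      ((insert a A)ᶜ).card * κ := by
    intro x
    have := hκA x
    rw [avg_eq_sum_switch hτ hA ha, div_le_iff₀ hn, mul_comm κ] at this
    exact this
  rw [hrep, abs_div, Nat.abs_cast, div_le_iff₀ hn]
  calc |∑ y ∈ (insert a A)ᶜ, avg A' τ (fun σ => f (switch y b σ) - f σ)|
      ≤ ∑ y ∈ (insert a A)ᶜ, 6 * ((avg A' τ (throughCount α m y) + avg A' τ (throughCount α m b)) +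
          (avg A' τ (fun σ => throughCount α m a (switch y b σ)) +
            avg A' τ (fun σ => throughCount α m b (switch y b σ)))) := by
        refine (Finset.abs_sum_le_sum_abs _ _).trans (Finset.sum_le_sum fun y hy => ?_)
        refine (abs_avg_le _ _).trans ((avg_mono (hpt y hy)).trans_eq ?_)
        rw [avg_const_mul, avg_add, avg_add, avg_add]
    _ ≤ 6 * ((((insert a A)ᶜ).card * κ + ((insert a A)ᶜ).card * κ) +
          (((insert a A)ᶜ).card * κ + ((insert a A)ᶜ).card * κ)) := by
        rw [← Finset.mul_sum, Finset.sum_add_distrib, Finset.sum_add_distrib,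
          Finset.sum_add_distrib]
        have h1 : ∑ y ∈ (insert a A)ᶜ, avg A' τ (throughCount α m y) ≤
            ((insert a A)ᶜ).card * κ :=
          (Finset.sum_le_card_nsmul _ _ κ fun y _ => hκA' y).trans_eq (by rw [nsmul_eq_mul])
        have h2 : ∑ y ∈ (insert a A)ᶜ, avg A' τ (throughCount α m b) ≤
            ((insert a A)ᶜ).card * κ :=
          (Finset.sum_le_card_nsmul _ _ κ fun y _ => hκA' b).trans_eq (by rw [nsmul_eq_mul])
        have h3 := hsw a
        have h4 := hsw b
        linarith
    _ = 24 * κ * ((insert a A)ᶜ).card := by ring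

/-- Prescribing a simple curve `α` changes the law of the count vector by little more than adding
`α` to it. -/
theorem abs_avg_sub_avg_labels_le (hN : 1 ≤ N) {m : ℕ} (hk : k ≤ m) (hm : m ≤ N)
    {τ : Equiv.Perm (Label N)} (hτ : IsMatching τ) {α : ZMod k → Passage N} (hα : Simple α)
    (hατ : Occurs τ α) {W : Finset WordClass} (hW : ∀ c ∈ W, 1 ≤ c.length ∧ c.length ≤ m)
    (c : W) (hc : c.1.length = k) (htype : turnClass α = c.1) (g : (W → ℕ) → ℝ)
    (hg : ∀ z, |g z| ≤ 3) :
    |avg ∅ τ (fun σ => g (curveCountVector N W (gluingOf σ) + Pi.single c 1)) -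
      avg (labels α) τ (fun σ => g (curveCountVector N W (gluingOf σ)))| ≤
      3 / N + 48 * m * (m * ((m + 1) * (12 * m + 6) ^ m / (2 * N))) := by
  classical
  set κ : ℝ := m * ((m + 1) * (12 * m + 6) ^ m / (2 * N)) with hκ
  have hκ0 : 0 ≤ κ := by positivity
  have hN' : (1 : ℝ) ≤ N := by exact_mod_cast hN
  set f : Equiv.Perm (Label N) → ℝ := fun σ =>
    g (otherCount (curveClass α) W (gluingOf σ) + Pi.single c 1) with hf
  have hlab : avg (labels α) τ (fun σ => g (curveCountVector N W (gluingOf σ))) =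
      avg (labels α) τ f := by
    unfold avg
    congr 1
    refine Finset.sum_congr rfl fun σ hσ => ?_
    obtain ⟨h1, h2⟩ := mem_matchings.mp hσ
    have hocc : Occurs (matchingOf (gluingOf σ)) α := by
      rw [matchingOf_gluingOf h1]
      exact (hατ.iff_eqOn h1 hτ).mpr h2
    exact congrArg g (curveCountVector_of_occurs c hc hα.cyclicPrimitive htype _ hocc)
  -- Omitting α from the count matters only if α occurs, which has probability at most 1/(2N), and
  -- then changes the value by at most 6.
  have h1 : |avg ∅ τ (fun σ => g (curveCountVector N W (gluingOf σ) + Pi.single c 1)) -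
      avg ∅ τ f| ≤ 3 / N := by
    rw [← avg_sub]
    have hocc := avg_occursInd_le hN (τ := τ) (A := ∅) (fun x hx => absurd hx (by simp)) α
      (by rw [Finset.card_empty]; omega) 0 fun σ _ _ => by
        rw [Finset.empty_union, hα.card_labels, Finset.card_empty]
        have := NeZero.one_le (n := k)
        omega
    refine (abs_avg_le _ _).trans ((avg_mono (G := fun σ => 6 * occursInd α σ)
      fun σ hσ => ?_).trans ?_)
    · have hm := (mem_matchings.mp hσ).1
      by_cases ho : Occurs σ α
      · rw [show occursInd α σ = 1 from if_pos ho]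
        have h1 := abs_le.mp (hg (curveCountVector N W (gluingOf σ) + Pi.single c 1))
        have h2 := abs_le.mp (hg (otherCount (curveClass α) W (gluingOf σ) + Pi.single c 1))
        rw [abs_le]
        constructor <;> linarith
      · rw [curveCountVector_of_not_occurs W hα.cyclicPrimitive (gluingOf σ) (by
          rwa [matchingOf_gluingOf hm]), sub_self, abs_zero]
        have := occursInd_nonneg α σ
        linarith
    · rw [avg_const_mul]
      refine (mul_le_mul_of_nonneg_left hocc (by norm_num)).trans_eq ?_
      field_simp
      ring
  have h2 : |avg ∅ τ f - avg (labels α) τ f| ≤ (labels α).card * (24 * κ) := by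
    refine abs_avg_empty_sub_le hτ (hατ.closedUnder hτ) f _ fun C a hC hCα haα haC => ?_
    refine abs_avg_sub_avg_addPair_le hN hk hm hτ hα hατ f (fun σ => hg _)
      (fun σ σ' hσ hσ' hne => ?_) hC hCα haα haC
    have := exists_of_otherCount_ne α hW (ω := gluingOf σ) (ω' := gluingOf σ') fun h =>
      hne (by simp only [hf, h])
    rwa [matchingOf_gluingOf hσ, matchingOf_gluingOf hσ'] at this
  rw [hlab]
  have h3 := abs_add_le
    (avg ∅ τ (fun σ => g (curveCountVector N W (gluingOf σ) + Pi.single c 1)) - avg ∅ τ f)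
    (avg ∅ τ f - avg (labels α) τ f)
  rw [sub_add_sub_cancel] at h3
  have h4 : ((labels α).card : ℝ) ≤ 2 * m := by
    exact_mod_cast (card_labels_le α).trans (by omega)
  have h5 : ((labels α).card : ℝ) * (24 * κ) ≤ 2 * m * (24 * κ) := by gcongr
  linarith

end Perturbation

/-! ### The bound for fixed `N` -/

section Bound

variable {N : ℕ}

theorem avg_empty_congr {τ τ' : Equiv.Perm (Label N)} (hτ : IsMatching τ)
    (F : Equiv.Perm (Label N) → ℝ) : avg ∅ τ F = avg ∅ τ' F := by
  unfold avg
  rw [matchings_congr (mem_matchings.mpr ⟨hτ, by simp⟩ : τ ∈ matchings ∅ τ')]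

theorem pairingWeight_pos {k : ℕ} (hk : k ≤ N) : 0 < pairingWeight N k := by
  refine Finset.prod_pos fun i hi => ?_
  rw [Finset.mem_range] at hi
  have h1 : (i : ℝ) + 1 ≤ N := by exact_mod_cast hi.trans_le hk
  have h2 : (0 : ℝ) ≤ i := Nat.cast_nonneg i
  linarith

theorem sum_gluing_div_card (τ : Equiv.Perm (Label N)) (F : Gluing N → ℝ) :
    (∑ ω, F ω) / Fintype.card (Gluing N) = avg ∅ τ fun σ => F (gluingOf σ) := by
  have h1 := sum_gluing_eq_sum_matchings τ fun σ => F (gluingOf σ)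
  have h2 := sum_gluing_eq_sum_matchings τ fun _ => 1
  simp only [gluingOf_matchingOf] at h1
  simp only [Finset.sum_const, nsmul_eq_mul, mul_one, Finset.card_univ] at h2
  rw [h1, h2, avg]

theorem curveCount_gluingOf {k : ℕ} [NeZero k] {c : WordClass} (hc : c.length = k)
    {σ : Equiv.Perm (Label N)} (hσ : IsMatching σ) :
    (curveCount N c (gluingOf σ) : ℝ) =
      (∑ s ∈ curvesWithType N k c, occursInd s σ) / (2 * k) := by
  classical
  have h1 := two_mul_curveCount (gluingOf σ) hc
  rw [matchingOf_gluingOf hσ] at h1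
  have h2 : ∑ s ∈ curvesWithType N k c, occursInd s σ =
      ((curvesWithType N k c).filter fun s => Occurs σ s).card := by
    unfold occursInd
    rw [Finset.sum_boole]
  have hk : (k : ℝ) ≠ 0 := by exact_mod_cast NeZero.ne k
  rw [h2, ← h1]
  push_cast
  field_simp

/-- Bookkeeping for the Stein bound: a is the class size, K = 2k, E the normalized expected number
of simple curves, x and y the simple and non-simple contributions. -/
theorem abs_sub_add_div_le {a G E x y M D B K : ℝ} (ha0 : 0 ≤ a) (haK : a ≤ K) (hK : 1 ≤ K)
    (hG : |G| ≤ 3) (hE1 : |E - 1| ≤ M) (hE2 : E ≤ 2) (hD : 0 ≤ D)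
    (hx : |a * E * G - x| ≤ a * E * D) (hy : |y| ≤ 3 * B) (hB : 0 ≤ B) :
    |(a * G - (x + y)) / K| ≤ 3 * M + 2 * D + 3 * B := by
  have hM : 0 ≤ M := (abs_nonneg _).trans hE1
  have h1 : |a * (G * (E - 1))| ≤ a * (3 * M) := by
    rw [abs_mul, abs_mul, abs_of_nonneg ha0]
    exact mul_le_mul_of_nonneg_left (mul_le_mul hG hE1 (abs_nonneg _) (by norm_num)) ha0
  have h2 : a * E * D ≤ a * (2 * D) := by
    rw [mul_assoc]
    exact mul_le_mul_of_nonneg_left (mul_le_mul_of_nonneg_right hE2 hD) ha0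
  have h3 : a * (3 * M + 2 * D) ≤ K * (3 * M + 2 * D) :=
    mul_le_mul_of_nonneg_right haK (by positivity)
  have h4 : 3 * B ≤ K * (3 * B) := le_mul_of_one_le_left (by positivity) hK
  have h5 : |a * G - (x + y)| ≤ a * (3 * M) + a * (2 * D) + 3 * B := by
    have h2' := hx.trans h2
    rw [abs_le] at h1 h2' hy ⊢
    constructor <;> linarith
  rw [abs_div, abs_of_pos (by linarith : 0 < K), div_le_iff₀ (by linarith)]
  linarith

theorem abs_stein_le (hN : 1 ≤ N) {m : ℕ} (hm : m ≤ N) {W : Finset WordClass}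
    (hW : ∀ c ∈ W, 1 ≤ c.length ∧ c.length ≤ m) (c : W) (g : (W → ℕ) → ℝ) (hg : ∀ z, |g z| ≤ 3) :
    |(∑ ω, ((c.1.rate : ℝ) * g (curveCountVector N W ω + Pi.single c 1) -
      curveCountVector N W ω c * g (curveCountVector N W ω))) / Fintype.card (Gluing N)| ≤
      3 * (m ^ 2 / (2 * N)) +
        2 * (3 / N + 48 * m * (m * ((m + 1) * (12 * m + 6) ^ m / (2 * N)))) +
        3 * ((m + 1) * (12 * m + 6) ^ m / (2 * N)) := by
  classical
  set B : ℝ := (m + 1) * (12 * m + 6) ^ m / (2 * N) with hB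
  set Δ : ℝ := 3 / N + 48 * m * (m * B) with hΔ
  have hB0 : 0 ≤ B := by positivity
  have hΔ0 : 0 ≤ Δ := by positivity
  obtain ⟨hk1, hkm⟩ := hW c.1 c.2
  obtain ⟨k, hk⟩ : ∃ k, c.1.length = k := ⟨_, rfl⟩
  rw [hk] at hk1 hkm
  have : NeZero k := ⟨by omega⟩
  obtain ⟨τ, hτ⟩ := exists_isMatching N
  set X : Equiv.Perm (Label N) → ℝ := fun σ => g (curveCountVector N W (gluingOf σ)) with hX
  set G : ℝ := avg ∅ τ (fun σ => g (curveCountVector N W (gluingOf σ) + Pi.single c 1)) with hG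
  have hG3 : |G| ≤ 3 :=
    (abs_avg_le _ _).trans ((avg_mono fun σ _ => hg _).trans_eq (avg_const hτ _ _))
  set S := curvesWithType N k c.1 with hS
  set T : (ZMod k → Passage N) → ℝ := fun s => avg ∅ τ fun σ => occursInd s σ * X σ with hT
  have hk0 : (0 : ℝ) < 2 * k := by positivity
  -- Both terms are put over 2k: the rate is size/(2k), and the count is 1/(2k) times the number of
  -- occurring sequences.
  have hrep : (∑ ω, ((c.1.rate : ℝ) * g (curveCountVector N W ω + Pi.single c 1) -
      curveCountVector N W ω c * g (curveCountVector N W ω))) / Fintype.card (Gluing N) =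
      (c.1.size * G - ∑ s ∈ S, T s) / (2 * k) := by
    rw [sum_gluing_div_card τ, avg_sub, avg_const_mul]
    have h1 : (avg ∅ τ fun σ => (curveCountVector N W (gluingOf σ) c : ℝ) *
        g (curveCountVector N W (gluingOf σ))) = (∑ s ∈ S, T s) / (2 * k) := by
      rw [hT, ← avg_sum, div_eq_inv_mul, ← avg_const_mul]
      unfold avg
      congr 1
      refine Finset.sum_congr rfl fun σ hσ => ?_
      have := curveCount_gluingOf hk (mem_matchings.mp hσ).1
      change (curveCount N c.1 (gluingOf σ) : ℝ) * X σ =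
        (2 * (k : ℝ))⁻¹ * ∑ s ∈ S, occursInd s σ * X σ
      rw [this, ← Finset.sum_mul]
      ring
    have h2 : (c.1.rate : ℝ) = c.1.size / (2 * k) := by
      rw [WordClass.rate, hk]; push_cast; rfl
    rw [h1, h2, ← hG]
    ring
  have hP := pairingWeight_pos (hkm.trans hm)
  set P := pairingWeight N k with hPdef
  -- For simple s, `T s` is the probability 1/P times the mean of g(Z) given s, and that mean is
  -- within `Δ` of E g(Z + e_c).
  have hsimple : ∀ s ∈ S.filter Simple, |1 / P * G - T s| ≤ 1 / P * Δ := by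
    intro s hs
    obtain ⟨hs1, hs2⟩ := Finset.mem_filter.mp hs
    obtain ⟨ρ, hρ, hρs⟩ := hs2.exists_occurs
    have h1 : T s = 1 / P * avg (labels s) ρ X := by
      rw [hT, ← hs2.avg_occursInd_mul hρ hρs X]
      exact avg_empty_congr hτ _
    have h2 := abs_avg_sub_avg_labels_le hN hkm hm hρ hs2 hρs hW c hk
      (mem_curvesWithType.mp hs1).2 g hg
    rw [avg_empty_congr (τ' := τ) hρ] at h2
    rw [h1, ← mul_sub, abs_mul, abs_of_pos (by positivity : 0 < 1 / P)]
    exact mul_le_mul_of_nonneg_left h2 (by positivity)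
  have hns : ∑ s ∈ S.filter (fun s => ¬ Simple s), |T s| ≤ 3 * B := by
    calc ∑ s ∈ S.filter (fun s => ¬ Simple s), |T s|
        ≤ ∑ s ∈ S.filter (fun s => ¬ Simple s), 3 * avg ∅ τ (occursInd s) := by
          refine Finset.sum_le_sum fun s _ => ?_
          rw [← avg_const_mul]
          refine (abs_avg_le _ _).trans (avg_mono fun σ _ => ?_)
          rw [abs_mul, abs_of_nonneg (occursInd_nonneg s σ), mul_comm]
          exact mul_le_mul_of_nonneg_right (hg _) (occursInd_nonneg s σ)
      _ ≤ 3 * B := by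
          rw [← Finset.mul_sum]
          refine mul_le_mul_of_nonneg_left ?_ (by norm_num)
          refine sum_avg_occursInd_le hN hkm hm (fun x hx => absurd hx (by simp)) (by simp) ∅
            (by simp) _ fun s hs σ hσ h => ?_
          obtain ⟨hs1, hs2⟩ := Finset.mem_filter.mp hs
          exact h.card_ge_of_not_simple (mem_matchings.mp hσ).1 (mem_curvesWithType.mp hs1).1 hs2
  obtain ⟨hE1, hE2⟩ := abs_expected_simple_sub_one_le hN hk1 hkm hm
  set E : ℝ := ((2 * N).descFactorial k * 3 ^ k : ℕ) / P with hE
  have hcard : ((S.filter Simple).card : ℝ) * (1 / P) = c.1.size * E := by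
    rw [hS, card_simple_curvesWithType hk, hE]
    push_cast
    ring
  have hsize : (c.1.size : ℝ) ≤ 2 * k := by exact_mod_cast size_le hk
  have hsum : |(S.filter Simple).card * (1 / P) * G - ∑ s ∈ S.filter Simple, T s| ≤
      c.1.size * E * Δ := by
    have : (S.filter Simple).card * (1 / P) * G - ∑ s ∈ S.filter Simple, T s =
        ∑ s ∈ S.filter Simple, (1 / P * G - T s) := by
      rw [Finset.sum_sub_distrib, Finset.sum_const, nsmul_eq_mul, mul_assoc]
    rw [this, ← hcard]
    refine (Finset.abs_sum_le_sum_abs _ _).trans ((Finset.sum_le_sum hsimple).trans_eq ?_)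
    rw [Finset.sum_const, nsmul_eq_mul, mul_assoc]
  rw [hcard] at hsum
  have hy := (Finset.abs_sum_le_sum_abs T (S.filter fun s => ¬ Simple s)).trans hns
  have hk1' : (1 : ℝ) ≤ k := by exact_mod_cast hk1
  rw [hrep, ← Finset.sum_filter_add_sum_filter_not S Simple]
  exact abs_sub_add_div_le (Nat.cast_nonneg _) hsize (by linarith) hG3 hE1 hE2 hΔ0 hsum hy hB0

instance (N : ℕ) : MeasurableSingletonClass (Gluing N) := ⟨fun _ => trivial⟩

theorem dmTV_curveCountVector_le (hN : 1 ≤ N) (W : Finset WordClass)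
    (hpos : ∀ c ∈ W, 1 ≤ c.length) (hm : maxLength W ≤ N) :
    dmTV ((gluingMeasure N).map (curveCountVector N W)) (poissonVectorLaw W) ≤
      (W.card : ℝ) ^ 3 * (6 * (maxLength W : ℝ)) ^ (3 * maxLength W + 4) * (1 / (N : ℝ)) := by
  set m := maxLength W with hmdef
  have hW : ∀ c ∈ W, 1 ≤ c.length ∧ c.length ≤ m := fun c hc =>
    ⟨hpos c hc, Finset.le_sup (f := WordClass.length) hc⟩
  have hrate : ∀ c : W, c.1.rate ≤ 1 := by
    intro c
    have : NeZero c.1.length := ⟨by have := hpos c.1 c.2; omega⟩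
    refine div_le_one_of_le₀ ?_ (by positivity)
    exact_mod_cast size_le (c := c.1) rfl
  have h1 := dmTV_map_uniform_le (fun c : W => c.1.rate) hrate (curveCountVector N W) _
    fun c g hg => abs_stein_le hN hm hW c g hg
  refine h1.trans ?_
  rw [Finset.sum_const, nsmul_eq_mul, Finset.card_univ, Fintype.card_coe]
  rcases Finset.eq_empty_or_nonempty W with rfl | ⟨c, hc⟩
  · simp
  have hN' : (0 : ℝ) < N := by exact_mod_cast hN
  have hm1 : (1 : ℝ) ≤ m := by exact_mod_cast (hW c hc).1.trans (hW c hc).2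
  have hcard : (1 : ℝ) ≤ W.card := by exact_mod_cast Finset.card_pos.mpr ⟨c, hc⟩
  have hcard3 : (W.card : ℝ) ≤ (W.card : ℝ) ^ 3 := le_self_pow₀ hcard (by norm_num)
  rw [mul_assoc ((W.card : ℝ) ^ 3)]
  refine mul_le_mul hcard3 ?_ (by positivity) (by positivity)
  -- For m ≥ 1 one has 12m + 6 ≤ 18m ≤ (6m)^2.
  have hpow : (12 * m + 6 : ℝ) ^ m ≤ (6 * m) ^ (2 * m) := by
    rw [pow_mul]
    exact pow_le_pow_left₀ (by positivity) (by nlinarith) m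
  have hp1 : (1 : ℝ) ≤ (6 * m) ^ (2 * m) := one_le_pow₀ (by linarith)
  have hm2 : (m : ℝ) ≤ m ^ 3 := le_self_pow₀ hm1 (by norm_num)
  have hm3 : (m : ℝ) ^ 2 ≤ m ^ 3 := pow_le_pow_right₀ hm1 (by norm_num)
  set p : ℝ := (12 * m + 6 : ℝ) ^ m with hp
  set q : ℝ := (6 * m : ℝ) ^ (2 * m) with hq
  have hq3 : (m : ℝ) ^ 3 ≤ m ^ 3 * q := le_mul_of_one_le_right (by positivity) hp1
  -- In units of m^3 q the four terms contribute at most 3/2, 6, 96 and 3, in total less than 216 =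
  -- 6^3.
  have hkey : 3 * (m : ℝ) ^ 2 / 2 + 6 + 48 * m ^ 2 * ((m + 1) * p) + 3 * ((m + 1) * p) / 2 ≤
      (6 * m) ^ (3 * m + 4) := by
    have h2 : (m + 1) * p ≤ 2 * m * q := by
      have : 0 ≤ p := by positivity
      gcongr
      linarith
    have h3 : 48 * (m : ℝ) ^ 2 * ((m + 1) * p) ≤ 96 * (m ^ 3 * q) := by
      calc 48 * (m : ℝ) ^ 2 * ((m + 1) * p) ≤ 48 * (m : ℝ) ^ 2 * (2 * m * q) := by gcongr
        _ = _ := by ring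
    have h4 : m * q ≤ m ^ 3 * q := by gcongr
    have h5 : (216 : ℝ) * (m ^ 3 * q) = (6 * m) ^ (2 * m + 3) := by rw [pow_add, ← hq]; ring
    have h6 : (6 * m : ℝ) ^ (2 * m + 3) ≤ (6 * m) ^ (3 * m + 4) :=
      pow_le_pow_right₀ (by linarith) (by omega)
    linarith
  calc _ = (3 * (m : ℝ) ^ 2 / 2 + 6 + 48 * m ^ 2 * ((m + 1) * p) + 3 * ((m + 1) * p) / 2) *
        (1 / N) := by field_simp; ring
    _ ≤ _ := by gcongr

end Bound

theorem dmTV_nonneg {ι : Type} (μ ν : Measure (ι → ℕ)) : 0 ≤ dmTV μ ν :=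
  Real.iSup_nonneg fun _ => abs_nonneg _

end RandomSurface

end

/-- The quotient `WordClass` also contains the class of the empty word, which `hpos` excludes. -/
theorem mainTheorem2 (W : ℕ → Finset RandomSurface.WordClass)
    (hpos : ∀ N, 1 ≤ N → ∀ c ∈ W N, 1 ≤ c.length)
    (hm : ∀ N, 1 ≤ N → RandomSurface.maxLength (W N) ≤ N)
    (hlim : Tendsto
      (fun N : ℕ => ((W N).card : ℝ) ^ 3 *
        (6 * (RandomSurface.maxLength (W N) : ℝ)) ^ (3 * RandomSurface.maxLength (W N) + 4) *
        (1 / (N : ℝ)))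
      atTop (𝓝 0)) :
    Tendsto
      (fun N : ℕ => RandomSurface.dmTV
        ((RandomSurface.gluingMeasure N).map (RandomSurface.curveCountVector N (W N)))
        (RandomSurface.poissonVectorLaw (W N)))
      atTop (𝓝 0) := by
  refine squeeze_zero' (.of_forall fun N => RandomSurface.dmTV_nonneg _ _) ?_ hlim
  filter_upwards [eventually_ge_atTop 1] with N hN
  exact RandomSurface.dmTV_curveCountVector_le hN (W N) (hpos N hN) (hm N hN)
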